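/- Work on a word RAM with $w$-bit words. There are an absolute constant $C$ and a fixed query program (independent of $w$, $n$, $\sigma$ and the sequence) such that the following holds for every $n\ge 2$, every $\sigma\ge 1$ and every word size $w$ with $n,\sigma<2^w$. Every sequence $S[1..n]$ of elements drawn from $[1,\sigma]$ can be stored using at most $C\,n\lg\sigma$ bits (i.e. $\mathcal{O}(n\lg\sigma)$ bits), held in a constant number of read-only arrays, so that, given any subset $\mathcal{Y}\subseteq[1,\sigma]$ (as a list of its elements in any order) and any range $[i,j]$ with $1\le i\le j\le n$, the query program computes the frequencies in $S[i..j]$ of all $y\in\mathcal{Y}$, from the stored bits, the query and the word size only, in at most $C\,(1+|\mathcal{Y}|+\sigma/\lg n)$ steps. In particular, the time is $\mathcal{O}(|\mathcal{Y}|+\sigma/\lg n)$ for every non-empty $\mathcal{Y}$. Here $\lg=\log_2$, and a step is one unsigned arithmetic, bitwise, shift or comparison operation on words, one access to a cell of an array, one loading of a constant or no-op, or one evaluation of a branch or loop condition. -/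

import Mathlib

/-!
A word RAM with `w`-bit words.  Programs are finite, and do not depend on `w`; they use
registers, working arrays and read-only data arrays, all named by constants of the program.
Every register and every array cell holds one word, and arrays are addressed by words.
-/

namespace WordRAM

/-- The arithmetic, bitwise, shift and comparison operations on words. -/
inductive Op where
  | add | sub | mul | div | mod
  | and | or | xor
  | shl | shr
  | eq | lt

/-- The value of an operation: unsigned arithmetic modulo `2 ^ w`; comparisons return `0` or `1`;
division by zero returns `0`. -/
def Op.eval {w : ℕ} : Op → BitVec w → BitVec w → BitVec w
  | .add, a, b => a + b
  | .sub, a, b => a - b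
  | .mul, a, b => a * b
  | .div, a, b => a / b
  | .mod, a, b => a % b
  | .and, a, b => a &&& b
  | .or, a, b => a ||| b
  | .xor, a, b => a ^^^ b
  | .shl, a, b => a <<< b.toNat
  | .shr, a, b => a >>> b.toNat
  | .eq, a, b => BitVec.ofNat w (if a = b then 1 else 0)
  | .lt, a, b => BitVec.ofNat w (if a.toNat < b.toNat then 1 else 0)

/-- Programs with access to `K` read-only data arrays. -/
inductive Prog (K : ℕ) where
  /-- do nothing -/
  | skip
  /-- register `x` := the constant `c` (modulo `2 ^ w`) -/
  | const (x c : ℕ)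
  /-- register `x` := `o` (register `y`) (register `z`) -/
  | op (o : Op) (x y z : ℕ)
  /-- register `x` := cell of the data array `k` whose address is in register `a` -/
  | read (x : ℕ) (k : Fin K) (a : ℕ)
  /-- register `x` := cell of the working array `m` whose address is in register `a` -/
  | load (x m a : ℕ)
  /-- cell of the working array `m` whose address is in register `a` := register `x` -/
  | store (m a x : ℕ)
  /-- sequential composition -/
  | seq (p q : Prog K)
  /-- run `p` if register `x` is nonzero and `q` otherwise -/
  | ite (x : ℕ) (p q : Prog K)
  /-- repeat `p` as long as register `x` is nonzero -/
  | loop (x : ℕ) (p : Prog K)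

/-- The mutable part of the machine: the registers and the working arrays. -/
structure State (w : ℕ) where
  /-- contents of the registers -/
  reg : ℕ → BitVec w
  /-- contents of the working arrays: name of the array, address -/
  mem : ℕ → BitVec w → BitVec w

/-- Assignment to a register. -/
def State.setReg {w : ℕ} (s : State w) (x : ℕ) (v : BitVec w) : State w :=
  { s with reg := Function.update s.reg x v }

/-- Assignment to a cell of a working array. -/
def State.setMem {w : ℕ} (s : State w) (m : ℕ) (a v : BitVec w) : State w :=
  { s with mem := Function.update s.mem m (Function.update (s.mem m) a v) }

/-- `Exec data p s s' t`: with the contents `data` of the data arrays, the program `p` started in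
state `s` halts in state `s'` after exactly `t` steps.  Each instruction takes one step, and so
does each evaluation of the condition of a branching or of a loop. -/
inductive Exec {w K : ℕ} (data : Fin K → BitVec w → BitVec w) :
    Prog K → State w → State w → ℕ → Prop where
  | skip (s : State w) : Exec data .skip s s 1
  | const (s : State w) (x c : ℕ) :
      Exec data (.const x c) s (s.setReg x (BitVec.ofNat w c)) 1
  | op (s : State w) (o : Op) (x y z : ℕ) :
      Exec data (.op o x y z) s (s.setReg x (o.eval (s.reg y) (s.reg z))) 1
  | read (s : State w) (x : ℕ) (k : Fin K) (a : ℕ) :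
      Exec data (.read x k a) s (s.setReg x (data k (s.reg a))) 1
  | load (s : State w) (x m a : ℕ) :
      Exec data (.load x m a) s (s.setReg x (s.mem m (s.reg a))) 1
  | store (s : State w) (m a x : ℕ) :
      Exec data (.store m a x) s (s.setMem m (s.reg a) (s.reg x)) 1
  | seq {p q : Prog K} {s s' s'' : State w} {t t' : ℕ} :
      Exec data p s s' t → Exec data q s' s'' t' → Exec data (.seq p q) s s'' (t + t')
  | iteTrue {x : ℕ} {p q : Prog K} {s s' : State w} {t : ℕ} :
      s.reg x ≠ 0 → Exec data p s s' t → Exec data (.ite x p q) s s' (t + 1)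
  | iteFalse {x : ℕ} {p q : Prog K} {s s' : State w} {t : ℕ} :
      s.reg x = 0 → Exec data q s s' t → Exec data (.ite x p q) s s' (t + 1)
  | loopDone {x : ℕ} {p : Prog K} {s : State w} :
      s.reg x = 0 → Exec data (.loop x p) s s 1
  | loopStep {x : ℕ} {p : Prog K} {s s' s'' : State w} {t t' : ℕ} :
      s.reg x ≠ 0 → Exec data p s s' t → Exec data (.loop x p) s' s'' t' →
        Exec data (.loop x p) s s'' (t + t' + 1)

/-- A bit string as the contents of an array of `w`-bit words: the cell with address `a` holds
the bits number `a * w, …, a * w + w - 1`, least significant bit first; beyond the end of the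
string all bits are zero. -/
def packBits (w : ℕ) (l : List Bool) (a : BitVec w) : BitVec w :=
  BitVec.ofNat w (∑ t ∈ Finset.range w, if l.getD (a.toNat * w + t) false then 2 ^ t else 0)

end WordRAM

/-- The frequency of the symbol `y` in `S[i..j]`. -/
def rangeFreq (S : ℕ → ℕ) (i j y : ℕ) : ℕ :=
  ((Finset.Icc i j).filter fun p => S p = y).card

/-- `s` is an initial state for the query with range `[i, j]` and set of symbols `Y` (listed in
some order): registers `0`, `1`, `2` hold `i`, `j` and the number of symbols, register `3` holds
the word size, and the working array `0` holds the symbols.  Everything else in the working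
memory is arbitrary, for instance left over from earlier queries. -/
structure IsFreqQuery {w : ℕ} (i j : ℕ) (Y : List ℕ) (s : WordRAM.State w) : Prop where
  left : s.reg 0 = BitVec.ofNat w i
  right : s.reg 1 = BitVec.ofNat w j
  size : s.reg 2 = BitVec.ofNat w Y.length
  wordSize : s.reg 3 = BitVec.ofNat w w
  symbols : ∀ (q : ℕ) (hq : q < Y.length), s.mem 0 (BitVec.ofNat w q) = BitVec.ofNat w Y[q]

/-- In state `s`, the working array `1` holds the frequencies in `S[i..j]` of all the symbols of
`Y`, in the order in which the symbols are listed. -/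
def HasFreqAnswers {w : ℕ} (S : ℕ → ℕ) (i j : ℕ) (Y : List ℕ) (s : WordRAM.State w) : Prop :=
  ∀ (q : ℕ) (hq : q < Y.length),
    s.mem 1 (BitVec.ofNat w q) = BitVec.ofNat w (rangeFreq S i j Y[q])

namespace WordRAM

/-! Give position `p` the key `(S p - 1) * 2 ^ v + (p - 1)` with `n < 2 ^ v`, and let `keyRank`
count the keys below a given number. The frequency of a symbol in a range is a difference of two
such ranks, taken at points with the same symbol part (`keyRank_add_rangeFreq`). It remains to store
the set of keys in `O(n lg σ)` bits so that ranking one position for many symbols is cheap in total.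

Let `L` and `l` be the rounded logarithms of `n` and `σ`, and let `2 ^ a` be about `L / l`. Keys are
split into groups of `2 ^ u` consecutive values, where `2 ^ u` is of order `σ L / l` unless capped
by the word size. There are `O(n l / L)` groups (`Sizes.groupCount_mul_le`), so each can afford
`O(L)` bits, among them the rank of its start. Inside a group only `u`-bit remainders matter.

If `a ≤ 2 * l + 8`, then `u = O(l)` and the sorted remainders themselves fit. They are packed into
chunks of `q = 2 ^ (a - 6)`, and a chunk is ranked by one table lookup, or by one comparison when `q
= 1` (`fieldsBelow_chunkNum`). To find the first chunk worth inspecting, a group is cut into `k =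
Θ(L)` blocks of `2 ^ me` values. The ranks of the block starts are rounded down to units of about a
`k`-th of the group; this is a monotone function from `[0, k)` to itself with a unary code of `2 *
k` bits (`unaryDecode_unary`). A query then scans the keys between its block start and itself, about
a `k`-th of the group, and `O(1)` further chunks (`chunks_inspected_le`).

The scans are short on average. For a fixed position and varying symbols, windows of length `D` at
the query points contain at most `D` keys altogether, because the distance from a key to its query
point determines the position and then the symbol (`sum_keyRank_sub_le`). The total excess is
therefore `O(2 ^ me / q) = O(σ / L)` chunks (`sum_cost_le`, `Sizes.block_mul_le`).

If `2 * l + 8 < a`, the alphabet is so small that ranks can be kept for every symbol at every `2 ^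
(a - 5)`-th position, relative to the group. A table indexed by the contents of a text block
supplies the rest in constant time (`denseRank_runs`). For `σ = 1` nothing is stored. -/

/-- The contents of a register as a natural number. -/
def State.val {w : ℕ} (s : State w) (x : ℕ) : ℕ := (s.reg x).toNat

theorem State.val_setReg {w : ℕ} (s : State w) (x y : ℕ) (b : BitVec w) :
    (s.setReg x b).val y = if y = x then b.toNat else s.val y := by
  by_cases h : y = x <;> simp [State.val, State.setReg, h]

theorem State.reg_setReg {w : ℕ} (s : State w) (x y : ℕ) (b : BitVec w) :
    (s.setReg x b).reg y = if y = x then b else s.reg y := by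
  by_cases h : y = x <;> simp [State.setReg, h]

/-- The program `p`, started in `s`, halts in a state and after a number of steps that
satisfy `Q`. -/
def Runs {w K : ℕ} (data : Fin K → BitVec w → BitVec w) (p : Prog K) (s : State w)
    (Q : State w → ℕ → Prop) : Prop :=
  ∃ s' t, Exec data p s s' t ∧ Q s' t

/-! ### Rules for program runs and their step counts -/

section Rules

variable {w K : ℕ} {data : Fin K → BitVec w → BitVec w} {p p' : Prog K} {s : State w}
  {Q Q' : State w → ℕ → Prop}

theorem Runs.mono (h : Runs data p s Q') (hQ : ∀ s' t, Q' s' t → Q s' t) : Runs data p s Q := by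
  obtain ⟨s', t, he, hq⟩ := h
  exact ⟨s', t, he, hQ _ _ hq⟩

theorem Runs.seq (h : Runs data p s fun s' t => Runs data p' s' fun s'' t' => Q s'' (t + t')) :
    Runs data (.seq p p') s Q := by
  obtain ⟨s', t, he, s'', t', he', hq⟩ := h
  exact ⟨s'', t + t', .seq he he', hq⟩

theorem Runs.bind (h : Runs data p s Q')
    (h' : ∀ s' t, Q' s' t → Runs data p' s' fun s'' t' => Q s'' (t + t')) :
    Runs data (.seq p p') s Q :=
  Runs.seq (h.mono h')

theorem Runs.const {x c : ℕ} (h : Q (s.setReg x (BitVec.ofNat w c)) 1) :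
    Runs data (.const x c) s Q := ⟨_, _, .const .., h⟩

theorem Runs.op {o : Op} {x y z : ℕ} (h : Q (s.setReg x (o.eval (s.reg y) (s.reg z))) 1) :
    Runs data (.op o x y z) s Q := ⟨_, _, .op .., h⟩

theorem Runs.read {x a : ℕ} {k : Fin K} (h : Q (s.setReg x (data k (s.reg a))) 1) :
    Runs data (.read x k a) s Q := ⟨_, _, .read .., h⟩

theorem Runs.load {x m a : ℕ} (h : Q (s.setReg x (s.mem m (s.reg a))) 1) :
    Runs data (.load x m a) s Q := ⟨_, _, .load .., h⟩

theorem Runs.store {x m a : ℕ} (h : Q (s.setMem m (s.reg a) (s.reg x)) 1) :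
    Runs data (.store m a x) s Q := ⟨_, _, .store .., h⟩

theorem Runs.iteTrue {x : ℕ} (hx : s.val x ≠ 0) (h : Runs data p s fun s' t => Q s' (t + 1)) :
    Runs data (.ite x p p') s Q := by
  obtain ⟨s', t, he, hq⟩ := h
  refine ⟨s', t + 1, .iteTrue (fun h0 => hx ?_) he, hq⟩
  simp [State.val, h0]

theorem Runs.iteFalse {x : ℕ} (hx : s.val x = 0) (h : Runs data p' s fun s' t => Q s' (t + 1)) :
    Runs data (.ite x p p') s Q := by
  obtain ⟨s', t, he, hq⟩ := h
  refine ⟨s', t + 1, .iteFalse (BitVec.eq_of_toNat_eq ?_) he, hq⟩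
  simpa [State.val] using hx

/-- A loop whose invariant carries a bound on the number of steps still to be made. -/
theorem Runs.loop {x : ℕ} (I : ℕ → ℕ → State w → Prop) {P : State w → Prop}
    (hstep : ∀ d τ s, I d τ s → s.val x ≠ 0 → ∃ d' τ', d' < d ∧
      Runs data p s fun s' t => I d' τ' s' ∧ t + 1 + τ' ≤ τ)
    (hdone : ∀ d τ s, I d τ s → s.val x = 0 → 1 ≤ τ ∧ P s)
    (d τ : ℕ) (h : I d τ s) : Runs data (.loop x p) s fun s' t => P s' ∧ t ≤ τ := by
  induction d using Nat.strong_induction_on generalizing s τ with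
  | _ d ih =>
    by_cases hx : s.val x = 0
    · obtain ⟨h1, h2⟩ := hdone d τ s h hx
      refine ⟨s, 1, .loopDone (BitVec.eq_of_toNat_eq (by simpa [State.val] using hx)), h2, h1⟩
    · obtain ⟨d', τ', hd, s', t, he, hI, ht⟩ := hstep d τ s h hx
      obtain ⟨s'', t', he', hP, ht'⟩ := ih d' hd τ' hI
      refine ⟨s'', t + t' + 1, .loopStep (fun h0 => hx (by simp [State.val, h0])) he he', hP, ?_⟩
      omega

end Rules

/-! ### Word operations as arithmetic of natural numbers -/

theorem Op.toNat_add {w : ℕ} {a b : BitVec w} (h : a.toNat + b.toNat < 2 ^ w) :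
    (Op.add.eval a b).toNat = a.toNat + b.toNat := by
  simp [Op.eval, Nat.mod_eq_of_lt h]

theorem Op.toNat_sub {w : ℕ} {a b : BitVec w} (h : b.toNat ≤ a.toNat) :
    (Op.sub.eval a b).toNat = a.toNat - b.toNat :=
  BitVec.toNat_sub_of_le h

theorem Op.toNat_mul {w : ℕ} {a b : BitVec w} (h : a.toNat * b.toNat < 2 ^ w) :
    (Op.mul.eval a b).toNat = a.toNat * b.toNat := by
  simp [Op.eval, Nat.mod_eq_of_lt h]

theorem Op.toNat_div {w : ℕ} {a b : BitVec w} :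
    (Op.div.eval a b).toNat = a.toNat / b.toNat := by
  simp [Op.eval]

theorem Op.toNat_mod {w : ℕ} {a b : BitVec w} :
    (Op.mod.eval a b).toNat = a.toNat % b.toNat := by
  simp [Op.eval]

theorem Op.toNat_shr {w : ℕ} {a b : BitVec w} :
    (Op.shr.eval a b).toNat = a.toNat / 2 ^ b.toNat := by
  simp [Op.eval, Nat.shiftRight_eq_div_pow]

theorem Op.toNat_shl {w : ℕ} {a b : BitVec w} (h : a.toNat * 2 ^ b.toNat < 2 ^ w) :
    (Op.shl.eval a b).toNat = a.toNat * 2 ^ b.toNat := by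
  simp [Op.eval, Nat.shiftLeft_eq, Nat.mod_eq_of_lt h]

theorem Op.toNat_or_self {w : ℕ} {a : BitVec w} : (Op.or.eval a a).toNat = a.toNat := by
  simp [Op.eval]

/-- Remainder modulo a power of two that may be too large for a word by one. -/
theorem Op.toNat_mod_shl {w : ℕ} {a b c : BitVec w} (hb : b.toNat = 1) (hc : c.toNat ≤ w) :
    (Op.mod.eval a (Op.shl.eval b c)).toNat = a.toNat % 2 ^ c.toNat := by
  rw [Op.toNat_mod]
  rcases hc.lt_or_eq with h | h
  · rw [Op.toNat_shl (by rw [hb, one_mul]; exact Nat.pow_lt_pow_right (by norm_num) h), hb, one_mul]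
  -- The shifted `1` is the zero word here, and the remainder modulo zero is the dividend.
  · rw [h, Nat.mod_eq_of_lt a.isLt]
    simp [Op.eval, h]

theorem Op.toNat_lt {w : ℕ} (hw : 0 < w) {a b : BitVec w} :
    (Op.lt.eval a b).toNat = if a.toNat < b.toNat then 1 else 0 := by
  have : 1 < 2 ^ w := Nat.one_lt_two_pow hw.ne'
  simp only [Op.eval]
  split_ifs <;> simp [Nat.mod_eq_of_lt this]

theorem Op.toNat_eq {w : ℕ} (hw : 0 < w) {a b : BitVec w} :
    (Op.eq.eval a b).toNat = if a.toNat = b.toNat then 1 else 0 := by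
  have : 1 < 2 ^ w := Nat.one_lt_two_pow hw.ne'
  simp only [Op.eval, BitVec.toNat_inj]
  split_ifs <;> simp [Nat.mod_eq_of_lt this]

theorem Op.toNat_and_indicator {w : ℕ} {a b : BitVec w} {p q : Prop} [Decidable p] [Decidable q]
    (ha : a.toNat = if p then 1 else 0) (hb : b.toNat = if q then 1 else 0) :
    (Op.and.eval a b).toNat = if p ∧ q then 1 else 0 := by
  simp only [Op.eval, BitVec.toNat_and, ha, hb]
  by_cases hp : p <;> by_cases hq : q <;> simp [hp, hq]

theorem State.val_const {w c : ℕ} (h : c < 2 ^ w) : (BitVec.ofNat w c).toNat = c := by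
  simp [Nat.mod_eq_of_lt h]

/-! ### Packed arrays -/

/-- The first `len` values of a bit sequence. -/
def bitList (len : ℕ) (b : ℕ → Bool) : List Bool := (List.range len).map b

theorem length_bitList (len : ℕ) (b : ℕ → Bool) : (bitList len b).length = len := by
  simp [bitList]

theorem getD_bitList (len : ℕ) (b : ℕ → Bool) (i : ℕ) :
    (bitList len b).getD i false = (decide (i < len) && b i) := by
  by_cases h : i < len <;> simp [bitList, List.getD, h]

theorem sum_bits_lt (w : ℕ) (b : ℕ → Bool) :
    ∑ t ∈ Finset.range w, (if b t then 2 ^ t else 0) < 2 ^ w := by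
  induction w with
  | zero => simp
  | succ w ih => rw [Finset.sum_range_succ, pow_succ]; split_ifs <;> omega

theorem sum_bits_testBit (w : ℕ) (b : ℕ → Bool) (i : ℕ) :
    (∑ t ∈ Finset.range w, if b t then 2 ^ t else 0).testBit i = (decide (i < w) && b i) := by
  have hlt := fun w => sum_bits_lt w b
  induction w with
  | zero => simp
  | succ w ih =>
    rw [Finset.sum_range_succ, add_comm]
    by_cases hw : b w
    · simp only [hw, if_true]
      rcases lt_trichotomy i w with h | h | h
      · rw [Nat.testBit_two_pow_add_gt h, ih]; simp [h, h.trans (Nat.lt_succ_self w)]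
      · subst h; rw [Nat.testBit_two_pow_add_eq, Nat.testBit_lt_two_pow (hlt i)]; simp [hw]
      · rw [Nat.testBit_lt_two_pow]
        · have : ¬ i < w + 1 := by omega
          simp [this]
        · have h1 := hlt w
          have h2 : 2 ^ (w + 1) ≤ 2 ^ i := Nat.pow_le_pow_right (by norm_num) h
          rw [pow_succ] at h2; omega
    · simp only [hw, Bool.false_eq_true, if_false, zero_add, ih]
      by_cases h : i = w
      · subst h; simp [hw]
      · have : i < w ↔ i < w + 1 := by omega
        simp [this]

theorem packBits_testBit (w : ℕ) (l : List Bool) (a : BitVec w) (i : ℕ) :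
    (packBits w l a).toNat.testBit i = (decide (i < w) && l.getD (a.toNat * w + i) false) := by
  rw [packBits, BitVec.toNat_ofNat, Nat.testBit_mod_two_pow,
    sum_bits_testBit w (fun t => l.getD (a.toNat * w + t) false)]
  simp

/-- The number `x` as a bit string. -/
def numBits (x : ℕ) : List Bool := bitList x x.testBit

theorem packBits_numBits {w x : ℕ} (hx : x < 2 ^ w) {a : BitVec w} (ha : a.toNat = 0) :
    (packBits w (numBits x) a).toNat = x := by
  refine Nat.eq_of_testBit_eq fun i => ?_
  rw [packBits_testBit, numBits, getD_bitList, ha, zero_mul, zero_add]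
  by_cases h1 : i < w
  -- A list of length `x` is long enough because `x < 2 ^ x`; all later bits of `x` vanish.
  · by_cases h2 : i < x
    · simp [h1, h2]
    · rw [Nat.testBit_lt_two_pow (x := x) (i := i)]
      · simp [h2]
      · exact (Nat.lt_two_pow_self).trans_le (Nat.pow_le_pow_right (by norm_num) (not_lt.1 h2))
  · rw [Nat.testBit_lt_two_pow (x := x) (i := i)]
    · simp [h1]
    · exact hx.trans_le (Nat.pow_le_pow_right (by norm_num) (not_lt.1 h1))

/-- The `f`-bit numbers `g 0, …, g (T - 1)`, with `w / f` of them in each group of `w` bits. -/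
def fieldList (w f T : ℕ) (g : ℕ → ℕ) : List Bool :=
  bitList (T / (w / f) * w + T % (w / f) * f) fun i =>
    (g (i / w * (w / f) + i % w / f)).testBit (i % w % f)

theorem length_fieldList_le {w f : ℕ} (T : ℕ) (g : ℕ → ℕ) (hf : 0 < f) (hfw : f ≤ w) :
    (fieldList w f T g).length ≤ 2 * (T * f) := by
  rw [fieldList, length_bitList]
  have hc : 0 < w / f := Nat.div_pos hfw hf
  set c := w / f
  -- Fewer than `f` bits of each word are left unused, hence at most half of it.
  have h1 : w ≤ 2 * (c * f) := by
    have h2 := Nat.lt_mul_div_succ w hf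
    have h3 : f ≤ c * f := Nat.le_mul_of_pos_left f hc
    change w < f * (c + 1) at h2
    nlinarith
  have h4 : T / c * w ≤ T / c * (2 * (c * f)) := Nat.mul_le_mul_left _ h1
  have h5 : c * (T / c) + T % c = T := Nat.div_add_mod T c
  calc T / c * w + T % c * f ≤ T / c * (2 * (c * f)) + 2 * (T % c * f) := by omega
    _ = 2 * ((c * (T / c) + T % c) * f) := by ring
    _ = _ := by rw [h5]

theorem packBits_fieldList {w f T t : ℕ} (g : ℕ → ℕ) (hf : 0 < f) (hfw : f ≤ w) (ht : t < T)
    {a : BitVec w} (ha : a.toNat = t / (w / f)) :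
    (packBits w (fieldList w f T g) a).toNat / 2 ^ (t % (w / f) * f) % 2 ^ f = g t % 2 ^ f := by
  have hc : 0 < w / f := Nat.div_pos hfw hf
  refine Nat.eq_of_testBit_eq fun i => ?_
  rw [Nat.testBit_mod_two_pow, Nat.testBit_mod_two_pow, Nat.testBit_div_two_pow]
  by_cases hi : i < f
  swap
  · simp [hi]
  simp only [hi, decide_true, Bool.true_and]
  rw [packBits_testBit, fieldList, getD_bitList, ha]
  set c := w / f with hcdef
  have hcf : c * f ≤ w := Nat.div_mul_le_self w f
  have hj : t % c < c := Nat.mod_lt _ hc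
  have hjf : (t % c + 1) * f ≤ c * f := Nat.mul_le_mul_right _ hj
  -- No field straddles two words, so all bits of field `t` lie in word `t / c`.
  have hlt : i + t % c * f < w := by nlinarith
  have e1 : (t / c * w + (i + t % c * f)) / w = t / c := by
    rw [mul_comm, Nat.mul_add_div (by omega), Nat.div_eq_of_lt hlt, add_zero]
  have e2 : (t / c * w + (i + t % c * f)) % w = i + t % c * f := by
    rw [Nat.mul_add_mod', Nat.mod_eq_of_lt hlt]
  have e3 : (i + t % c * f) / f = t % c := by
    rw [Nat.add_mul_div_right _ _ hf, Nat.div_eq_of_lt hi, zero_add]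
  have e4 : (i + t % c * f) % f = i := by
    rw [Nat.add_mul_mod_self_right, Nat.mod_eq_of_lt hi]
  have e5 : t / c * c + t % c = t := Nat.div_add_mod' t c
  rw [e1, e2, e3, e4, e5]
  -- The list ends after the fields of the last, partly filled word; field `t` lies either in an
  -- earlier word or in an earlier slot of that word.
  have hlen : t / c * w + (i + t % c * f) < T / c * w + T % c * f := by
    rcases (Nat.div_le_div_right (c := c) ht.le).lt_or_eq with h | h
    · have : (t / c + 1) * w ≤ T / c * w := Nat.mul_le_mul_right _ h
      rw [add_one_mul] at this
      generalize T % c * f = z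
      omega
    · have h6 : T / c * c + T % c = T := Nat.div_add_mod' T c
      have h7 : t % c < T % c := by rw [h] at e5; omega
      have h8 : (t % c + 1) * f ≤ T % c * f := Nat.mul_le_mul_right _ h7
      rw [h]; nlinarith
  simp [hlt, hlen]

/-! ### Reading a field of a packed array -/

/-- Copy register `y` to register `x`. -/
def copy {K : ℕ} (x y : ℕ) : Prog K := .op .or x y y

/-- Copy to register `40` the field of array `k` with the index in register `41` and the width in
register `42`. -/
def fetch {K : ℕ} (k : Fin K) : Prog K :=
  .seq (.op .div 43 3 42) <| .seq (.op .div 44 41 43) <| .seq (.read 44 k 44) <|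
  .seq (.op .mod 43 41 43) <| .seq (.op .mul 43 43 42) <| .seq (.op .shr 44 44 43) <|
  .seq (.const 43 1) <| .seq (.op .shl 43 43 42) (.op .mod 40 44 43)

/-- `s'` agrees with `s` outside the registers from number `b` on. -/
structure Frame {w : ℕ} (b : ℕ) (s s' : State w) : Prop where
  reg : ∀ x < b, s'.val x = s.val x
  mem : s'.mem = s.mem

theorem Frame.refl {w b : ℕ} (s : State w) : Frame b s s := ⟨fun _ _ => rfl, rfl⟩

theorem Frame.setReg {w b x : ℕ} {s s' : State w} (h : Frame b s s') (hx : b ≤ x) (c : BitVec w) :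
    Frame b s (s'.setReg x c) :=
  ⟨fun y hy => by rw [State.val_setReg, if_neg (by omega), h.reg y hy], h.mem⟩

theorem fetch_runs {w K : ℕ} {data : Fin K → BitVec w → BitVec w} {k : Fin K} {s : State w}
    {f T t : ℕ} {g : ℕ → ℕ} (hdata : data k = packBits w (fieldList w f T g))
    (h3 : s.val 3 = w) (h42 : s.val 42 = f) (h41 : s.val 41 = t) (hf : 0 < f) (hfw : f ≤ w)
    (ht : t < T) (hg : g t < 2 ^ f) :
    Runs data (fetch k) s fun s' τ => τ = 9 ∧ s'.val 40 = g t ∧ Frame 40 s s' := by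
  have hw : w < 2 ^ w := Nat.lt_two_pow_self
  have hc : 0 < w / f := Nat.div_pos hfw hf
  have hj : t % (w / f) * f < 2 ^ w := by
    have h1 : t % (w / f) * f ≤ w / f * f := Nat.mul_le_mul_right _ (Nat.mod_lt _ hc).le
    have h2 := Nat.div_mul_le_self w f
    omega
  unfold fetch
  iterate 8 refine Runs.seq ?_; first | apply Runs.op | apply Runs.read | apply Runs.const
  apply Runs.op
  have h3' : (s.reg 3).toNat = w := h3
  have h41' : (s.reg 41).toNat = t := h41
  have h42' : (s.reg 42).toNat = f := h42
  refine ⟨rfl, ?_, ?_⟩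
  · simp only [State.val_setReg, State.reg_setReg, reduceIte,
      Nat.reduceEqDiff, hdata]
    have e43 : (Op.div.eval (s.reg 3) (s.reg 42)).toNat = w / f := by
      rw [Op.toNat_div, h3', h42']
    have e44 : (Op.div.eval (s.reg 41) (Op.div.eval (s.reg 3) (s.reg 42))).toNat
        = t / (w / f) := by
      rw [Op.toNat_div, h41', e43]
    have e43' : (Op.mod.eval (s.reg 41) (Op.div.eval (s.reg 3) (s.reg 42))).toNat
        = t % (w / f) := by
      rw [Op.toNat_mod, h41', e43]
    rw [Op.toNat_mod_shl (State.val_const (Nat.one_lt_two_pow (by omega))) (by rw [h42']; exact hfw),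
      Op.toNat_shr, Op.toNat_mul (by rw [e43', h42']; exact hj), e43', h42',
      packBits_fieldList g hf hfw ht e44, Nat.mod_eq_of_lt hg]
  · repeat (first | exact Frame.refl _ | refine Frame.setReg ?_ (by norm_num) _)

end WordRAM

/-! ### Symbolic execution on valuations of registers -/

namespace WordRAM

/-- The registers below number `40` have the values `E`, and the working arrays the contents `m`. -/
structure Models {w : ℕ} (s : State w) (E : ℕ → ℕ) (m : ℕ → BitVec w → BitVec w) : Prop where
  val : ∀ x < 40, s.val x = E x
  mem : s.mem = m

section Steps

variable {w K : ℕ} {data : Fin K → BitVec w → BitVec w} {p : Prog K} {s : State w}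
  {Q : State w → ℕ → Prop} {E : ℕ → ℕ} {m : ℕ → BitVec w → BitVec w} {x y z : ℕ}

theorem Models.setReg (hM : Models s E m) {b : BitVec w} {v : ℕ} (hb : b.toNat = v) :
    Models (s.setReg x b) (Function.update E x v) m :=
  ⟨fun i hi => by
    rw [State.val_setReg, Function.update_apply, hb, hM.val i hi], hM.mem⟩

/-- The continuation receives an arbitrary state known only through its valuation. Long programs are
thus traced with numbers in place of nested word expressions, and overflow is settled once per
instruction. -/
theorem Models.op (o : Op) (hM : Models s E m) (v : ℕ)
    (hv : ∀ a b : BitVec w, a.toNat = E y → b.toNat = E z → (o.eval a b).toNat = v)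
    (h : ∀ s', Models s' (Function.update E x v) m → Runs data p s' fun s'' t => Q s'' (1 + t))
    (hy : y < 40 := by norm_num) (hz : z < 40 := by norm_num) :
    Runs data (.seq (.op o x y z) p) s Q :=
  Runs.seq (Runs.op (h _ (hM.setReg (hv _ _ (hM.val y hy) (hM.val z hz)))))

theorem Models.add (hM : Models s E m) (v : ℕ) (hv : E y + E z = v) (hlt : v < 2 ^ w)
    (h : ∀ s', Models s' (Function.update E x v) m → Runs data p s' fun s'' t => Q s'' (1 + t))
    (hy : y < 40 := by norm_num) (hz : z < 40 := by norm_num) :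
    Runs data (.seq (.op .add x y z) p) s Q :=
  hM.op _ v (fun a b ha hb => by
    rw [Op.toNat_add (by rw [ha, hb, hv]; exact hlt), ha, hb, hv]) h hy hz

theorem Models.sub (hM : Models s E m) (v : ℕ) (hv : E y - E z = v) (hle : E z ≤ E y)
    (h : ∀ s', Models s' (Function.update E x v) m → Runs data p s' fun s'' t => Q s'' (1 + t))
    (hy : y < 40 := by norm_num) (hz : z < 40 := by norm_num) :
    Runs data (.seq (.op .sub x y z) p) s Q :=
  hM.op _ v (fun a b ha hb => by
    rw [Op.toNat_sub (by rw [ha, hb]; exact hle), ha, hb, hv]) h hy hz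

theorem Models.mul (hM : Models s E m) (v : ℕ) (hv : E y * E z = v) (hlt : v < 2 ^ w)
    (h : ∀ s', Models s' (Function.update E x v) m → Runs data p s' fun s'' t => Q s'' (1 + t))
    (hy : y < 40 := by norm_num) (hz : z < 40 := by norm_num) :
    Runs data (.seq (.op .mul x y z) p) s Q :=
  hM.op _ v (fun a b ha hb => by
    rw [Op.toNat_mul (by rw [ha, hb, hv]; exact hlt), ha, hb, hv]) h hy hz

theorem Models.div (hM : Models s E m) (v : ℕ) (hv : E y / E z = v)
    (h : ∀ s', Models s' (Function.update E x v) m → Runs data p s' fun s'' t => Q s'' (1 + t))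
    (hy : y < 40 := by norm_num) (hz : z < 40 := by norm_num) :
    Runs data (.seq (.op .div x y z) p) s Q :=
  hM.op _ v (fun a b ha hb => by rw [Op.toNat_div, ha, hb, hv]) h hy hz

theorem Models.shr (hM : Models s E m) (v : ℕ) (hv : E y / 2 ^ E z = v)
    (h : ∀ s', Models s' (Function.update E x v) m → Runs data p s' fun s'' t => Q s'' (1 + t))
    (hy : y < 40 := by norm_num) (hz : z < 40 := by norm_num) :
    Runs data (.seq (.op .shr x y z) p) s Q :=
  hM.op _ v (fun a b ha hb => by rw [Op.toNat_shr, ha, hb, hv]) h hy hz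

theorem Models.shl (hM : Models s E m) (v : ℕ) (hv : E y * 2 ^ E z = v) (hlt : v < 2 ^ w)
    (h : ∀ s', Models s' (Function.update E x v) m → Runs data p s' fun s'' t => Q s'' (1 + t))
    (hy : y < 40 := by norm_num) (hz : z < 40 := by norm_num) :
    Runs data (.seq (.op .shl x y z) p) s Q :=
  hM.op _ v (fun a b ha hb => by
    rw [Op.toNat_shl (by rw [ha, hb, hv]; exact hlt), ha, hb, hv]) h hy hz

theorem Models.lt (hM : Models s E m) (hw : 0 < w) (v : ℕ) (hv : (if E y < E z then 1 else 0) = v)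
    (h : ∀ s', Models s' (Function.update E x v) m → Runs data p s' fun s'' t => Q s'' (1 + t))
    (hy : y < 40 := by norm_num) (hz : z < 40 := by norm_num) :
    Runs data (.seq (.op .lt x y z) p) s Q :=
  hM.op _ v (fun a b ha hb => by rw [Op.toNat_lt hw, ha, hb, hv]) h hy hz

theorem Models.eq (hM : Models s E m) (hw : 0 < w) (v : ℕ) (hv : (if E y = E z then 1 else 0) = v)
    (h : ∀ s', Models s' (Function.update E x v) m → Runs data p s' fun s'' t => Q s'' (1 + t))
    (hy : y < 40 := by norm_num) (hz : z < 40 := by norm_num) :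
    Runs data (.seq (.op .eq x y z) p) s Q :=
  hM.op _ v (fun a b ha hb => by rw [Op.toNat_eq hw, ha, hb, hv]) h hy hz

theorem Models.and (hM : Models s E m) {P P' : Prop} [Decidable P] [Decidable P']
    (h1 : E y = if P then 1 else 0) (h2 : E z = if P' then 1 else 0)
    (h : ∀ s', Models s' (Function.update E x (if P ∧ P' then 1 else 0)) m →
      Runs data p s' fun s'' t => Q s'' (1 + t))
    (hy : y < 40 := by norm_num) (hz : z < 40 := by norm_num) :
    Runs data (.seq (.op .and x y z) p) s Q :=
  hM.op _ _ (fun _ _ ha hb => Op.toNat_and_indicator (ha.trans h1) (hb.trans h2)) h hy hz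

theorem Models.copy (hM : Models s E m) (v : ℕ) (hv : E y = v)
    (h : ∀ s', Models s' (Function.update E x v) m → Runs data p s' fun s'' t => Q s'' (1 + t))
    (hy : y < 40 := by norm_num) :
    Runs data (.seq (copy x y) p) s Q :=
  Runs.seq (Runs.op (h _ (hM.setReg (by rw [Op.toNat_or_self, ← hv]; exact hM.val y hy))))

theorem Models.const (hM : Models s E m) {c : ℕ} (hc : c < 2 ^ w)
    (h : ∀ s', Models s' (Function.update E x c) m → Runs data p s' fun s'' t => Q s'' (1 + t)) :
    Runs data (.seq (.const x c) p) s Q :=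
  Runs.seq (Runs.const (h _ (hM.setReg (State.val_const hc))))

theorem Models.read (hM : Models s E m) {k : Fin K} (v : ℕ)
    (hv : ∀ a : BitVec w, a.toNat = E y → (data k a).toNat = v)
    (h : ∀ s', Models s' (Function.update E x v) m → Runs data p s' fun s'' t => Q s'' (1 + t))
    (hy : y < 40 := by norm_num) :
    Runs data (.seq (.read x k y) p) s Q :=
  Runs.seq (Runs.read (h _ (hM.setReg (hv _ (hM.val y hy)))))

theorem Models.load (hM : Models s E m) {k : ℕ} (v : ℕ)
    (hv : ∀ a : BitVec w, a.toNat = E y → (m k a).toNat = v)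
    (h : ∀ s', Models s' (Function.update E x v) m → Runs data p s' fun s'' t => Q s'' (1 + t))
    (hy : y < 40 := by norm_num) :
    Runs data (.seq (.load x k y) p) s Q :=
  Runs.seq (Runs.load (h _ (hM.setReg (by rw [hM.mem]; exact hv _ (hM.val y hy)))))

theorem Models.store (hM : Models s E m) {k : ℕ}
    (h : ∀ s', Models s' E (Function.update m k (Function.update (m k)
        (BitVec.ofNat w (E x)) (BitVec.ofNat w (E y)))) →
      Runs data p s' fun s'' t => Q s'' (1 + t))
    (hx : x < 40 := by norm_num) (hy : y < 40 := by norm_num) :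
    Runs data (.seq (.store k x y) p) s Q := by
  refine Runs.seq (Runs.store (h _ ⟨hM.val, ?_⟩))
  rw [← hM.val x hx, ← hM.val y hy]
  simp [State.setMem, hM.mem, State.val]

/-- The remainder modulo a power of two, computed from a register holding `1`. -/
theorem Models.modPow (hM : Models s E m) {u : ℕ} (v e : ℕ) (h1 : E y = 1) (he : E z = e)
    (hew : e ≤ w) (hv : E u % 2 ^ e = v) (hux : u ≠ x)
    (h : ∀ s', Models s' (Function.update E x v) m → Runs data p s' fun s'' t => Q s'' (2 + t))
    (hy : y < 40 := by norm_num) (hz : z < 40 := by norm_num) (hu : u < 40 := by norm_num) :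
    Runs data (.seq (.op .shl x y z) (.seq (.op .mod x u x) p)) s Q := by
  refine Runs.seq (Runs.op (Runs.seq (Runs.op ?_)))
  rw [State.reg_setReg, State.reg_setReg, if_neg hux, if_pos rfl]
  have h2 : (Op.mod.eval (s.reg u) (Op.shl.eval (s.reg y) (s.reg z))).toNat = v := by
    have hz' : (s.reg z).toNat = e := (hM.val z hz).trans he
    have hu' : (s.reg u).toNat = E u := hM.val u hu
    rw [Op.toNat_mod_shl ((hM.val y hy).trans h1) (by rw [hz']; exact hew), hz', hu', hv]
  refine Runs.mono (Q' := fun s'' t => Q s'' (2 + t)) (h _ ⟨fun i hi => ?_, hM.mem⟩)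
    fun s' t hq => by rwa [← add_assoc]
  rw [State.val_setReg, State.val_setReg, Function.update_apply, h2]
  split_ifs
  · rfl
  · exact hM.val i hi

theorem Models.skip (hM : Models s E m) (h : ∀ s, Models s E m → Q s 1) : Runs data .skip s Q :=
  ⟨_, _, .skip .., h s hM⟩

end Steps

/-- Set register `x` to the field of array `k` with the index in register `y` and the width in
register `z`. -/
def fetchTo {K : ℕ} (k : Fin K) (x y z : ℕ) : Prog K :=
  .seq (copy 41 y) <| .seq (copy 42 z) <| .seq (fetch k) (copy x 40)

theorem Models.fetchTo {w K : ℕ} {data : Fin K → BitVec w → BitVec w} {p : Prog K}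
    {s : State w} {Q : State w → ℕ → Prop} {E : ℕ → ℕ} {m : ℕ → BitVec w → BitVec w}
    {x y z : ℕ} {k : Fin K} (hM : Models s E m) (f T t v : ℕ) {g : ℕ → ℕ}
    (hdata : data k = packBits w (fieldList w f T g)) (h3 : E 3 = w)
    (hz' : E z = f) (hy' : E y = t) (hf : 0 < f) (hfw : f ≤ w) (ht : t < T) (hv : g t = v)
    (hg : v < 2 ^ f)
    (h : ∀ s', Models s' (Function.update E x v) m → Runs data p s' fun s'' t => Q s'' (12 + t))
    (hy : y < 40 := by norm_num) (hz : z < 40 := by norm_num) :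
    Runs data (.seq (fetchTo k x y z) p) s Q := by
  refine Runs.bind (Q' := fun s' t => t = 12 ∧ Models s' (Function.update E x v) m) ?_ ?_
  swap
  · rintro s' t ⟨rfl, hM'⟩
    exact h s' hM'
  refine Runs.seq (Runs.op (Runs.seq (Runs.op (Runs.bind (fetch_runs (f := f) (t := t) hdata
    ?_ ?_ ?_ hf hfw ht (hv ▸ hg)) ?_))))
  · simp only [State.val_setReg, Nat.reduceEqDiff, if_false]
    rw [hM.val 3 (by norm_num), h3]
  · rw [State.val_setReg, if_pos rfl, Op.toNat_or_self, State.reg_setReg, if_neg (by omega), ← hz']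
    exact hM.val z hz
  · rw [State.val_setReg, if_neg (by norm_num), State.val_setReg, if_pos rfl, Op.toNat_or_self,
      ← hy']
    exact hM.val y hy
  · rintro s' t ⟨rfl, h40, hF⟩
    refine Runs.op ⟨rfl, fun i hi => ?_, hF.mem.trans hM.mem⟩
    rw [State.val_setReg, Function.update_apply, Op.toNat_or_self]
    split_ifs
    · exact h40.trans hv
    · rw [hF.reg i hi, State.val_setReg, if_neg (by omega), State.val_setReg, if_neg (by omega),
        hM.val i hi]

/-! ### Quotient and remainder of a key that may exceed a word -/

/-- The key need not fit into one word, so its quotient is assembled from symbol and position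
separately. Truncated subtraction merges the cases `u ≤ v` and `v ≤ u`: at least one of the two
shifts of `y` is by zero. -/
theorem div_two_pow_eq {u v y p : ℕ} (hp : p < 2 ^ v) :
    y / 2 ^ (u - v) * 2 ^ (v - u) + p / 2 ^ min u v = (y * 2 ^ v + p) / 2 ^ u := by
  rcases le_total u v with h | h
  · obtain ⟨d, rfl⟩ := Nat.exists_eq_add_of_le h
    simp only [Nat.sub_eq_zero_of_le h, pow_zero, Nat.div_one, Nat.add_sub_cancel_left,
      Nat.min_eq_left h]
    rw [pow_add, show y * (2 ^ u * 2 ^ d) + p = p + 2 ^ u * (y * 2 ^ d) by ring,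
      Nat.add_mul_div_left _ _ (by positivity)]
    ring
  · obtain ⟨d, rfl⟩ := Nat.exists_eq_add_of_le h
    simp only [Nat.sub_eq_zero_of_le h, pow_zero, mul_one, Nat.add_sub_cancel_left,
      Nat.min_eq_right h, Nat.div_eq_of_lt hp, add_zero]
    rw [pow_add, ← Nat.div_div_eq_div_mul, mul_comm y, Nat.mul_add_div (by positivity),
      Nat.div_eq_of_lt hp, add_zero]

theorem mod_two_pow_eq {u v y p : ℕ} (hp : p < 2 ^ v) :
    y % 2 ^ (u - v) * 2 ^ min u v + p % 2 ^ min u v = (y * 2 ^ v + p) % 2 ^ u := by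
  rcases le_total u v with h | h
  · obtain ⟨d, rfl⟩ := Nat.exists_eq_add_of_le h
    simp only [Nat.sub_eq_zero_of_le h, pow_zero, Nat.mod_one, zero_mul, zero_add,
      Nat.min_eq_left h]
    rw [pow_add, show y * (2 ^ u * 2 ^ d) + p = p + 2 ^ u * (y * 2 ^ d) by ring,
      Nat.add_mul_mod_self_left]
  · obtain ⟨d, rfl⟩ := Nat.exists_eq_add_of_le h
    simp only [Nat.add_sub_cancel_left, Nat.min_eq_right h, Nat.mod_eq_of_lt hp]
    have h1 : y = 2 ^ d * (y / 2 ^ d) + y % 2 ^ d := (Nat.div_add_mod y _).symm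
    have h2 : y % 2 ^ d < 2 ^ d := Nat.mod_lt _ (by positivity)
    have h3 : y * 2 ^ v + p
        = (y % 2 ^ d * 2 ^ v + p) + 2 ^ (v + d) * (y / 2 ^ d) := by
      rw [pow_add]; nth_rw 1 [h1]; ring
    have h4 : (y % 2 ^ d + 1) * 2 ^ v ≤ 2 ^ d * 2 ^ v := Nat.mul_le_mul_right _ h2
    rw [← pow_add, add_one_mul, add_comm d] at h4
    rw [h3, Nat.add_mul_mod_self_left, Nat.mod_eq_of_lt (by omega : y % 2 ^ d * 2 ^ v + p < _)]

/-- Registers holding the parameters of the data structure. -/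
structure HasParams (w v u me k q tbl se sw : ℕ) (E : ℕ → ℕ) : Prop where
  r3 : E 3 = w
  r6 : E 6 = v
  r7 : E 7 = u
  r8 : E 8 = u - v
  r9 : E 9 = v - u
  r10 : E 10 = min u v
  r11 : E 11 = me
  r12 : E 12 = k
  r13 : E 13 = q
  r14 : E 14 = tbl
  r15 : E 15 = se
  r16 : E 16 = sw
  r17 : E 17 = v - se

/-- Split the key `y * 2 ^ v + p` (with `p` in register `20` and `y` in register `21`) into its
quotient (register `25`) and its remainder (register `26`) modulo `2 ^ u`. -/
def locate {K : ℕ} (p : Prog K) : Prog K :=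
  .seq (.const 29 1) <| .seq (.op .shr 25 21 8) <| .seq (.op .shl 25 25 9) <|
  .seq (.op .shr 26 20 10) <| .seq (.op .add 25 25 26) <|
  .seq (.op .shl 26 29 8) <| .seq (.op .mod 26 21 26) <| .seq (.op .shl 26 26 10) <|
  .seq (.op .shl 27 29 10) <| .seq (.op .mod 27 20 27) <| .seq (.op .add 26 26 27) p

theorem Models.locate {w K : ℕ} {data : Fin K → BitVec w → BitVec w} {p : Prog K}
    {s : State w} {Q : State w → ℕ → Prop} {E : ℕ → ℕ} {m : ℕ → BitVec w → BitVec w}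
    {v u me k q tbl se sw a y : ℕ} (hM : Models s E m) (hE : HasParams w v u me k q tbl se sw E)
    (hvw : v ≤ w) (hw : 0 < w) (huw : u ≤ w) (ha : E 20 = a) (hy : E 21 = y) (hav : a < 2 ^ v)
    (hg : (y * 2 ^ v + a) / 2 ^ u < 2 ^ w)
    (h : ∀ s' E', Models s' E' m → (∀ i < 24, E' i = E i) →
      E' 25 = (y * 2 ^ v + a) / 2 ^ u → E' 26 = (y * 2 ^ v + a) % 2 ^ u → E' 29 = 1 →
      Runs data p s' fun s'' t => Q s'' (11 + t)) :
    Runs data (locate p) s Q := by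
  have e1 := div_two_pow_eq (u := u) (y := y) hav
  have e2 := mod_two_pow_eq (u := u) (y := y) hav
  have hr : (y * 2 ^ v + a) % 2 ^ u < 2 ^ w :=
    (Nat.mod_lt _ (by positivity)).trans_le (Nat.pow_le_pow_right (by norm_num) huw)
  refine hM.const (Nat.one_lt_two_pow hw.ne') fun s1 h1 => ?_
  refine h1.shr (y / 2 ^ (u - v)) (by simp [hy, hE.r8]) fun s2 h2 => ?_
  refine h2.shl (y / 2 ^ (u - v) * 2 ^ (v - u)) (by simp [hE.r9])
    ((Nat.le_add_right _ _).trans_lt (e1.trans_lt hg)) fun s3 h3 => ?_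
  refine h3.shr (a / 2 ^ min u v) (by simp [ha, hE.r10]) fun s4 h4 => ?_
  refine h4.add ((y * 2 ^ v + a) / 2 ^ u) (by simp [e1]) hg fun s5 h5 => ?_
  refine h5.modPow (y % 2 ^ (u - v)) (u - v) (by simp) (by simp [hE.r8]) (by omega)
    (by simp [hy]) (by norm_num) fun s6 h6 => ?_
  refine h6.shl (y % 2 ^ (u - v) * 2 ^ min u v) (by simp [hE.r10]) (by omega) fun s7 h7 => ?_
  refine h7.modPow (a % 2 ^ min u v) (min u v) (by simp) (by simp [hE.r10]) (by omega)
    (by simp [ha]) (by norm_num) fun s8 h8 => ?_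
  refine h8.add ((y * 2 ^ v + a) % 2 ^ u) (by simp [e2]) hr fun s9 h9 => ?_
  refine (h s9 _ h9 (fun i hi => ?_) (by simp) (by simp) (by simp)).mono fun s' t ht => ?_
  · repeat rw [Function.update_of_ne (by omega)]
  · convert ht using 1; omega

end WordRAM

/-! ### Packed tuples, thresholds of monotone functions and unary codes -/

/-- The `u`-bit numbers `fld 0, …, fld (q - 1)` packed into one number. -/
def packNat (u q : ℕ) (fld : ℕ → ℕ) : ℕ := ∑ j ∈ Finset.range q, fld j * 2 ^ (u * j)

theorem packNat_lt {u q : ℕ} {fld : ℕ → ℕ} (h : ∀ j, fld j < 2 ^ u) :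
    packNat u q fld < 2 ^ (u * q) := by
  induction q with
  | zero => simp [packNat]
  | succ q ih =>
    rw [packNat, Finset.sum_range_succ]
    change packNat u q fld + _ < _
    have h1 : (fld q + 1) * 2 ^ (u * q) ≤ 2 ^ u * 2 ^ (u * q) := Nat.mul_le_mul_right _ (h q)
    rw [mul_add, mul_one, pow_add, mul_comm (2 ^ (u * q))]
    rw [add_one_mul] at h1
    omega

theorem packNat_field {u q j : ℕ} {fld : ℕ → ℕ} (h : ∀ j, fld j < 2 ^ u) (hj : j < q) :
    packNat u q fld / 2 ^ (u * j) % 2 ^ u = fld j := by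
  induction q with
  | zero => omega
  | succ q ih =>
    rw [packNat, Finset.sum_range_succ]
    change (packNat u q fld + _) / _ % _ = _
    rcases Nat.lt_succ_iff_lt_or_eq.1 hj with h1 | rfl
    · obtain ⟨d, rfl⟩ := Nat.exists_eq_add_of_lt h1
      rw [show fld (j + d + 1) * 2 ^ (u * (j + d + 1))
          = 2 ^ u * (2 ^ (u * d) * fld (j + d + 1)) * 2 ^ (u * j) by ring,
        Nat.add_mul_div_right _ _ (by positivity), Nat.add_mul_mod_self_left, ih h1]
    · rw [Nat.add_mul_div_right _ _ (by positivity), Nat.div_eq_of_lt (packNat_lt h), zero_add,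
        Nat.mod_eq_of_lt (h _)]

/-- The first position after `b` at which the monotone function `R` exceeds `i`, relative to `b`
and less one, but at most `M`. -/
def thr (R : ℕ → ℕ) (b M i : ℕ) : ℕ := ((Finset.range M).filter fun x => R (b + x + 1) ≤ i).card

theorem thr_le (R : ℕ → ℕ) (b M i : ℕ) : thr R b M i ≤ M :=
  (Finset.card_filter_le _ _).trans (Finset.card_range M).le

/-- Monotonicity makes the counted offsets an initial segment. A stored threshold thus acts as the
remainder of the key of rank `i`, and the cap `M` acts as infinity for ranks beyond the group, since
`r ≤ M`. -/
theorem thr_lt_iff {R : ℕ → ℕ} (hR : Monotone R) {b M i r : ℕ} (hi : R b ≤ i) (hr : r ≤ M) :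
    thr R b M i < r ↔ i < R (b + r) := by
  constructor
  · intro h
    by_contra! h1
    have h2 : Finset.range r ⊆ (Finset.range M).filter fun x => R (b + x + 1) ≤ i := fun x hx => by
      have hx := Finset.mem_range.1 hx
      exact Finset.mem_filter.2 ⟨Finset.mem_range.2 (by omega), (hR (by omega)).trans h1⟩
    have := Finset.card_le_card h2
    rw [Finset.card_range] at this
    exact absurd h (not_lt.2 this)
  · intro h
    have hr0 : r ≠ 0 := by rintro rfl; simp at h; omega
    have h2 : ((Finset.range M).filter fun x => R (b + x + 1) ≤ i) ⊆ Finset.range (r - 1) :=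
      fun x hx => by
        have hx := (Finset.mem_filter.1 hx).2
        rw [Finset.mem_range]
        by_contra! h3
        have : R (b + r) ≤ R (b + x + 1) := hR (by omega)
        omega
    have := Finset.card_le_card h2
    rw [Finset.card_range] at this
    unfold thr
    omega

/-- The unary code of a monotone function from `[0, k)` to itself. -/
def unary (k : ℕ) (e : ℕ → ℕ) : ℕ :=
  ∑ i ∈ Finset.range (2 * k), if decide (∃ t < k, e t + t = i) then 2 ^ i else 0

/-- The value at `t` of the monotone function with unary code `c`. -/
noncomputable def unaryDecode (c t : ℕ) : ℕ := Nat.nth (fun i => c.testBit i) t - t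

theorem unary_lt (k : ℕ) (e : ℕ → ℕ) : unary k e < 2 ^ (2 * k) := WordRAM.sum_bits_lt _ _

/-- Adding `t` makes the monotone values strictly increasing, so the set bits below `e t + t` are
exactly those of smaller arguments, and the set bit number `t` is at `e t + t`. -/
theorem unaryDecode_unary {k t : ℕ} {e : ℕ → ℕ} (he : Monotone e) (hk : ∀ t < k, e t < k)
    (ht : t < k) : unaryDecode (unary k e) t = e t := by
  have hbit : ∀ i, (unary k e).testBit i = true ↔ ∃ t < k, e t + t = i := by
    intro i
    rw [unary, WordRAM.sum_bits_testBit (2 * k) (fun i => decide (∃ t < k, e t + t = i))]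
    simp only [Bool.and_eq_true, decide_eq_true_eq, and_iff_right_iff_imp]
    rintro ⟨t, ht, rfl⟩
    have := hk t ht
    omega
  have hcount : Nat.count (fun i => (unary k e).testBit i = true) (e t + t) = t := by
    rw [Nat.count_eq_card_filter_range]
    have : ((Finset.range (e t + t)).filter fun i => (unary k e).testBit i = true)
        = (Finset.range t).image fun j => e j + j := by
      ext i
      simp only [Finset.mem_filter, Finset.mem_range, Finset.mem_image, hbit]
      constructor
      · rintro ⟨h1, j, hj, rfl⟩
        refine ⟨j, ?_, rfl⟩
        by_contra! h2
        have := he h2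
        omega
      · rintro ⟨j, hj, rfl⟩
        have := he hj.le
        exact ⟨by omega, j, by omega, rfl⟩
    rw [this, Finset.card_image_of_injOn, Finset.card_range]
    intro a _ b _ hab
    simp only at hab
    rcases lt_trichotomy a b with h | h | h
    · have := he h.le; omega
    · exact h
    · have := he h.le; omega
  have h1 := Nat.nth_count (p := fun i => (unary k e).testBit i = true) (n := e t + t)
    ((hbit _).2 ⟨t, ht, rfl⟩)
  rw [hcount] at h1
  rw [unaryDecode, h1, Nat.add_sub_cancel]

/-! ### Chunks of the sorted list of keys -/

section Chunks

variable (u q : ℕ) (R : ℕ → ℕ)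

/-- The number of chunks of group `g`. -/
def groupChunks (g : ℕ) : ℕ := (R ((g + 1) * 2 ^ u) - R (g * 2 ^ u) + q - 1) / q

/-- The number of chunks of all groups before `g`. -/
def chunkStart (g : ℕ) : ℕ := ∑ i ∈ Finset.range g, groupChunks u q R i

/-- The group of chunk `c`, among `NG` groups. -/
def chunkGroup (NG c : ℕ) : ℕ := ((Finset.range NG).filter fun g => chunkStart u q R (g + 1) ≤ c).card

/-- The contents of chunk `c`. -/
def chunkNum (NG c : ℕ) : ℕ :=
  packNat u q fun j => thr R (chunkGroup u q R NG c * 2 ^ u) (2 ^ u - 1)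
    (R (chunkGroup u q R NG c * 2 ^ u) + q * (c - chunkStart u q R (chunkGroup u q R NG c)) + j)

/-- The number of the `q` fields of `c` that are less than `r`. -/
def fieldsBelow (c r : ℕ) : ℕ := ((Finset.range q).filter fun j => c / 2 ^ (u * j) % 2 ^ u < r).card

variable {u q R}

theorem chunkStart_mono : Monotone (chunkStart u q R) := fun a b h => by
  unfold chunkStart
  exact Finset.sum_le_sum_of_subset (Finset.range_mono h)

theorem chunkStart_succ (g : ℕ) :
    chunkStart u q R (g + 1) = chunkStart u q R g + groupChunks u q R g := Finset.sum_range_succ _ _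

theorem le_groupChunks (hq : 0 < q) (g : ℕ) :
    R ((g + 1) * 2 ^ u) - R (g * 2 ^ u) ≤ q * groupChunks u q R g := by
  unfold groupChunks
  have h1 := Nat.lt_mul_div_succ (R ((g + 1) * 2 ^ u) - R (g * 2 ^ u) + q - 1) hq
  rw [mul_add, mul_one] at h1
  omega

theorem groupChunks_mul_le (g : ℕ) :
    groupChunks u q R g * q ≤ R ((g + 1) * 2 ^ u) - R (g * 2 ^ u) + (q - 1) := by
  unfold groupChunks
  have h1 := Nat.div_mul_le_self (R ((g + 1) * 2 ^ u) - R (g * 2 ^ u) + q - 1) q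
  omega

theorem groupChunks_le (hq : 0 < q) (g : ℕ) :
    groupChunks u q R g ≤ R ((g + 1) * 2 ^ u) - R (g * 2 ^ u) := by
  unfold groupChunks
  refine Nat.le_of_lt_succ ((Nat.div_lt_iff_lt_mul hq).2 ?_)
  generalize R ((g + 1) * 2 ^ u) - R (g * 2 ^ u) = D
  have : D ≤ D * q := Nat.le_mul_of_pos_right _ hq
  rw [Nat.succ_mul]
  omega

theorem sum_groups (hR : Monotone R) (g : ℕ) :
    ∑ i ∈ Finset.range g, (R ((i + 1) * 2 ^ u) - R (i * 2 ^ u)) = R (g * 2 ^ u) - R 0 := by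
  induction g with
  | zero => simp
  | succ g ih =>
    have h1 : R 0 ≤ R (g * 2 ^ u) := hR (Nat.zero_le _)
    have h2 : R (g * 2 ^ u) ≤ R ((g + 1) * 2 ^ u) := hR (Nat.mul_le_mul_right _ (by omega))
    rw [Finset.sum_range_succ, ih]
    omega

theorem chunkStart_le (hq : 0 < q) (hR : Monotone R) (g : ℕ) :
    chunkStart u q R g ≤ R (g * 2 ^ u) :=
  calc chunkStart u q R g ≤ _ := Finset.sum_le_sum fun i _ => groupChunks_le hq i
    _ = R (g * 2 ^ u) - R 0 := sum_groups hR g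
    _ ≤ _ := Nat.sub_le _ _

/-- Only the last chunk of a group can be partly filled, so padding costs at most `q - 1` fields per
group. -/
theorem chunkStart_mul_le (hR : Monotone R) (g : ℕ) :
    chunkStart u q R g * q ≤ R (g * 2 ^ u) + g * (q - 1) :=
  calc chunkStart u q R g * q = ∑ i ∈ Finset.range g, groupChunks u q R i * q :=
        Finset.sum_mul ..
    _ ≤ ∑ i ∈ Finset.range g, (R ((i + 1) * 2 ^ u) - R (i * 2 ^ u) + (q - 1)) :=
        Finset.sum_le_sum fun i _ => groupChunks_mul_le i
    _ = R (g * 2 ^ u) - R 0 + g * (q - 1) := by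
        rw [Finset.sum_add_distrib, sum_groups hR]; simp
    _ ≤ _ := by omega

theorem chunkGroup_eq {NG g c : ℕ} (hg : g < NG) (h1 : chunkStart u q R g ≤ c)
    (h2 : c < chunkStart u q R (g + 1)) : chunkGroup u q R NG c = g := by
  have : ((Finset.range NG).filter fun g => chunkStart u q R (g + 1) ≤ c) = Finset.range g := by
    ext i
    simp only [Finset.mem_filter, Finset.mem_range]
    constructor
    · rintro ⟨_, h⟩
      by_contra! h3
      have := chunkStart_mono (u := u) (q := q) (R := R) (show g + 1 ≤ i + 1 by omega)
      omega
    · intro h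
      have := chunkStart_mono (u := u) (q := q) (R := R) (show i + 1 ≤ g by omega)
      exact ⟨by omega, by omega⟩
  rw [chunkGroup, this, Finset.card_range]

theorem chunkNum_lt (NG c : ℕ) : chunkNum u q R NG c < 2 ^ (q * u) := by
  rw [mul_comm]
  exact packNat_lt fun j => (thr_le _ _ _ _).trans_lt (Nat.sub_lt (by positivity) one_pos)

theorem fieldsBelow_le (c r : ℕ) : fieldsBelow u q c r ≤ q :=
  (Finset.card_filter_le _ _).trans (Finset.card_range q).le

/-- Field `j` represents the key of rank `q * δ + j` within the group. The fields below `r` are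
therefore an initial segment: the part of the rank of `r` not covered by the first `δ` chunks, cut
off at the chunk size. -/
theorem fieldsBelow_chunkNum (hR : Monotone R) {NG g δ r : ℕ} (hg : g < NG)
    (hδ : δ < groupChunks u q R g) (hr : r < 2 ^ u) :
    fieldsBelow u q (chunkNum u q R NG (chunkStart u q R g + δ)) r
      = min q (R (g * 2 ^ u + r) - R (g * 2 ^ u) - q * δ) := by
  have hgrp : chunkGroup u q R NG (chunkStart u q R g + δ) = g :=
    chunkGroup_eq hg (by omega) (by rw [chunkStart_succ]; omega)
  have : ((Finset.range q).filter fun j =>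
      chunkNum u q R NG (chunkStart u q R g + δ) / 2 ^ (u * j) % 2 ^ u < r)
      = Finset.range (min q (R (g * 2 ^ u + r) - R (g * 2 ^ u) - q * δ)) := by
    ext j
    simp only [Finset.mem_filter, Finset.mem_range, lt_min_iff]
    refine and_congr_right fun hj => ?_
    rw [chunkNum, packNat_field
      (fun j => (thr_le _ _ _ _).trans_lt (Nat.sub_lt (by positivity) one_pos)) hj, hgrp,
      thr_lt_iff hR (by omega) (by omega), Nat.add_sub_cancel_left]
    omega
  rw [fieldsBelow, this, Finset.card_range]

theorem fieldsBelow_one {c r : ℕ} (hc : c < 2 ^ u) :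
    fieldsBelow u 1 c r = if c < r then 1 else 0 := by
  simp only [fieldsBelow, Finset.range_one, Finset.filter_singleton, mul_zero, pow_zero,
    Nat.div_one, Nat.mod_eq_of_lt hc]
  split_ifs <;> simp

end Chunks

/-! ### Approximate ranks of block starts -/

section Skips

variable (u me k q : ℕ) (R : ℕ → ℕ)

/-- The rounding unit for group `g`, in chunks. -/
def skipUnit (g : ℕ) : ℕ := groupChunks u q R g / k + 1

/-- The number of rounding units before block `t` of group `g`. -/
def skipCount (g t : ℕ) : ℕ :=
  (R (g * 2 ^ u + t * 2 ^ me) - R (g * 2 ^ u)) / (q * skipUnit u k q R g)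

variable {u me k q R}

theorem skipCount_mono (hR : Monotone R) (g : ℕ) : Monotone (skipCount u me k q R g) :=
  fun _ _ h => Nat.div_le_div_right (Nat.sub_le_sub_right
    (hR (Nat.add_le_add_left (Nat.mul_le_mul_right _ h) _)) _)

/-- The unit exceeds a `k`-th of the chunks of the group, so `k` units overshoot the group. This is
what lets the rounded ranks fit into a unary code of `2 * k` bits. -/
theorem skipCount_lt (hR : Monotone R) (hk : 0 < k) (hq : 0 < q) (hku : k * 2 ^ me = 2 ^ u)
    {g t : ℕ} (ht : t < k) : skipCount u me k q R g t < k := by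
  have h1 : R (g * 2 ^ u + t * 2 ^ me) ≤ R ((g + 1) * 2 ^ u) := hR (by
    have := Nat.mul_le_mul_right (2 ^ me) ht.le
    rw [add_one_mul]; omega)
  have h2 := le_groupChunks (u := u) (R := R) hq g
  have h3 := Nat.lt_mul_div_succ (groupChunks u q R g) hk
  rw [skipCount, Nat.div_lt_iff_lt_mul (by unfold skipUnit; positivity)]
  calc _ ≤ q * groupChunks u q R g := by omega
    _ < q * (k * skipUnit u k q R g) := Nat.mul_lt_mul_of_pos_left h3 hq
    _ = _ := by ring

/-- The key is rounded down to its block start and the rank down to whole units, so the skipped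
chunks contain only keys below the query. -/
theorem skip_mul_le (hR : Monotone R) {g r : ℕ} :
    q * (skipUnit u k q R g * skipCount u me k q R g (r / 2 ^ me))
      ≤ R (g * 2 ^ u + r) - R (g * 2 ^ u) := by
  have h1 : R (g * 2 ^ u + r / 2 ^ me * 2 ^ me) ≤ R (g * 2 ^ u + r) :=
    hR (Nat.add_le_add_left (Nat.div_mul_le_self _ _) _)
  rw [← mul_assoc]
  exact (Nat.mul_div_le _ _).trans (Nat.sub_le_sub_right h1 _)

theorem skip_le (hR : Monotone R) (hq : 0 < q) {g r : ℕ} (hr : r < 2 ^ u) :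
    skipUnit u k q R g * skipCount u me k q R g (r / 2 ^ me) ≤ groupChunks u q R g := by
  have h1 := skip_mul_le (u := u) (me := me) (k := k) (q := q) hR (g := g) (r := r)
  have h2 := le_groupChunks (u := u) (R := R) hq g
  have h3 : R (g * 2 ^ u + r) ≤ R ((g + 1) * 2 ^ u) := hR (by rw [add_one_mul]; omega)
  exact Nat.le_of_mul_le_mul_left (by omega) hq

/-- The number of chunks inspected when ranking the key with remainder `r` in group `g`. -/
theorem chunks_inspected_le (hR : Monotone R) (hk : 0 < k) (hq : 0 < q) {g r : ℕ} :
    (R (g * 2 ^ u + r) - R (g * 2 ^ u)) / q + 1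
        - skipUnit u k q R g * skipCount u me k q R g (r / 2 ^ me)
      ≤ (R (g * 2 ^ u + r) - R (g * 2 ^ u + r / 2 ^ me * 2 ^ me)) / q
        + (R ((g + 1) * 2 ^ u) - R (g * 2 ^ u)) / (q * k) + 5 := by
  have h0 : R (g * 2 ^ u) ≤ R (g * 2 ^ u + r / 2 ^ me * 2 ^ me) := hR (by omega)
  have h1 : R (g * 2 ^ u + r / 2 ^ me * 2 ^ me) ≤ R (g * 2 ^ u + r) :=
    hR (Nat.add_le_add_left (Nat.div_mul_le_self _ _) _)
  have hE : 0 < skipUnit u k q R g := Nat.succ_pos _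
  -- Rounding the rank of the block start loses less than one unit, and a unit is about a `k`-th of
  -- the group, measured in chunks.
  have h2 : (R (g * 2 ^ u + r / 2 ^ me * 2 ^ me) - R (g * 2 ^ u)) / q
      < skipUnit u k q R g * skipCount u me k q R g (r / 2 ^ me) + skipUnit u k q R g := by
    rw [skipCount, ← Nat.div_div_eq_div_mul]
    exact Nat.lt_mul_div_succ _ hE
  have h3 : skipUnit u k q R g ≤ (R ((g + 1) * 2 ^ u) - R (g * 2 ^ u)) / (q * k) + 2 := by
    rw [skipUnit, groupChunks, ← Nat.div_div_eq_div_mul]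
    generalize R ((g + 1) * 2 ^ u) - R (g * 2 ^ u) = D
    have h4 : (D + q - 1) / q ≤ D / q + 1 := by
      rw [← Nat.add_div_right _ hq]
      exact Nat.div_le_div_right (by omega)
    have h5 : (D / q + 1) / k ≤ D / q / k + 1 := by
      rw [← Nat.add_div_right _ hk]
      exact Nat.div_le_div_right (by omega)
    have h6 := Nat.div_le_div_right (c := k) h4
    omega
  have h7 : (R (g * 2 ^ u + r) - R (g * 2 ^ u)) / q
      ≤ (R (g * 2 ^ u + r) - R (g * 2 ^ u + r / 2 ^ me * 2 ^ me)) / q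
        + (R (g * 2 ^ u + r / 2 ^ me * 2 ^ me) - R (g * 2 ^ u)) / q + 1 := by
    have : R (g * 2 ^ u + r) - R (g * 2 ^ u)
      = (R (g * 2 ^ u + r) - R (g * 2 ^ u + r / 2 ^ me * 2 ^ me))
        + (R (g * 2 ^ u + r / 2 ^ me * 2 ^ me) - R (g * 2 ^ u)) := by omega
    rw [this, Nat.add_div hq]
    split_ifs <;> omega
  generalize (R (g * 2 ^ u + r) - R (g * 2 ^ u + r / 2 ^ me * 2 ^ me)) / q = A at *
  generalize (R ((g + 1) * 2 ^ u) - R (g * 2 ^ u)) / (q * k) = B at *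
  omega

end Skips

/-! ### Ranking by scanning chunks of sorted keys -/

namespace WordRAM

/-- Inspect one chunk in the loop of `sparseRank`. -/
def chunkStep : Prog 23 :=
  .seq (fetchTo 18 35 30 33) <|
  .seq (.ite 14
    (.seq (.op .shl 35 35 7) <| .seq (.op .add 35 35 26) <| .seq (fetchTo 19 35 35 6) .skip)
    (.seq (.op .lt 35 35 26) .skip)) <|
  .seq (.op .add 24 24 35) <| .seq (.op .add 30 30 29) <| .seq (.op .eq 35 35 13) <|
  .seq (.op .lt 36 30 31) <| .seq (.op .and 34 35 36) .skip

/-- Rank a key with the help of chunks of sorted keys. -/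
def sparseRank : Prog 23 :=
  locate <|
  .seq (fetchTo 14 24 25 6) <| .seq (fetchTo 15 30 25 6) <| .seq (.op .add 35 25 29) <|
  .seq (fetchTo 15 31 35 6) <| .seq (.op .sub 32 31 30) <| .seq (.op .div 32 32 12) <|
  .seq (.op .add 32 32 29) <| .seq (.op .add 33 12 12) <| .seq (fetchTo 16 35 25 33) <|
  .seq (.op .mul 35 35 12) <| .seq (.op .shr 27 26 11) <| .seq (.op .add 35 35 27) <|
  .seq (fetchTo 17 35 35 6) <| .seq (.op .mul 32 32 35) <| .seq (.op .mul 27 32 13) <|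
  .seq (.op .add 24 24 27) <| .seq (.op .add 30 30 32) <| .seq (.op .mul 33 13 7) <|
  .seq (.op .lt 34 30 31) (.loop 34 chunkStep)

/-- The data arrays and the parameters of the structure for sparse alphabets. -/
structure SparseData (w v u me k q tbl NG : ℕ) (R : ℕ → ℕ)
    (data : Fin 23 → BitVec w → BitVec w) : Prop where
  mono : Monotone R
  bound : ∀ x, R x < 2 ^ v
  v_pos : 0 < v
  v_le : v ≤ w
  u_pos : 0 < u
  u_le : u ≤ w
  k_pos : 0 < k
  k_mul : k * 2 ^ me = 2 ^ u
  k_le : 2 * k ≤ w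
  k_lt : k ≤ 2 ^ v
  unary_le : 2 ^ (2 * k) * k ≤ 2 ^ w
  q_pos : 0 < q
  q_lt : q < 2 ^ v
  chunk_le : q * u ≤ w
  table_le : tbl ≠ 0 → q * u + u ≤ w
  q_eq : tbl = 0 → q = 1
  groups_lt : NG < 2 ^ w
  base : data 14 = packBits w (fieldList w v NG fun g => R (g * 2 ^ u))
  start : data 15 = packBits w (fieldList w v (NG + 1) (chunkStart u q R))
  skips : data 16 = packBits w (fieldList w (2 * k) NG fun g => unary k (skipCount u me k q R g))
  decode : data 17 = packBits w (fieldList w v (2 ^ (2 * k) * k) fun i =>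
    unaryDecode (i / k) (i % k))
  chunks : data 18 = packBits w (fieldList w (q * u) (chunkStart u q R NG) (chunkNum u q R NG))
  table : tbl ≠ 0 → data 19 = packBits w (fieldList w v (2 ^ (q * u + u)) fun i =>
    fieldsBelow u q (i / 2 ^ u) (i % 2 ^ u))

theorem update_low {E : ℕ → ℕ} {i b x v : ℕ} (hi : i < b) (hx : b ≤ x) :
    Function.update E x v i = E i :=
  Function.update_of_ne (by omega) ..

section Sparse

variable {w v u me k q tbl NG se sw : ℕ} {R : ℕ → ℕ} {data : Fin 23 → BitVec w → BitVec w}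

/-- The loop invariant of `sparseRank` after `δ` chunks of group `g`, for remainder `r`. -/
structure ChunkInv (v u q : ℕ) (R : ℕ → ℕ) (E : ℕ → ℕ) (g r δ : ℕ) (E' : ℕ → ℕ) : Prop where
  low : ∀ i < 24, E' i = E i
  acc : E' 24 = R (g * 2 ^ u) + min (R (g * 2 ^ u + r) - R (g * 2 ^ u)) (q * δ)
  rem : E' 26 = r
  one : E' 29 = 1
  cur : E' 30 = chunkStart u q R g + δ
  fin : E' 31 = chunkStart u q R (g + 1)
  width : E' 33 = q * u
  cond : E' 34 = if q * δ ≤ R (g * 2 ^ u + r) - R (g * 2 ^ u) ∧ δ < groupChunks u q R g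
    then 1 else 0
  le : δ ≤ groupChunks u q R g

/-- A chunk consists entirely of keys below the query exactly when the rank within the group reaches
`q * (δ + 1)`. Comparing the count with `q` therefore decides whether the scan must go on. -/
theorem chunkStep_runs (hD : SparseData w v u me k q tbl NG R data) {s : State w} {E E' : ℕ → ℕ}
    {m : ℕ → BitVec w → BitVec w} {g r δ : ℕ} (hE : HasParams w v u me k q tbl se sw E)
    (hg : g < NG) (hr : r < 2 ^ u) (hM : Models s E' m) (hI : ChunkInv v u q R E g r δ E')
    (hδ : δ < groupChunks u q R g) (hρ : q * δ ≤ R (g * 2 ^ u + r) - R (g * 2 ^ u)) :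
    Runs data chunkStep s fun s' t => t ≤ 35 ∧ ∃ E'', Models s' E'' m ∧
      ChunkInv v u q R E g r (δ + 1) E'' := by
  have hw : 0 < w := hD.v_pos.trans_le hD.v_le
  have hvw : 2 ^ v ≤ 2 ^ w := Nat.pow_le_pow_right (by norm_num) hD.v_le
  have e := fun i (hi : i < 24) => hI.low i hi
  have hlast : chunkStart u q R (g + 1) ≤ chunkStart u q R NG := chunkStart_mono hg
  have hsucc := chunkStart_succ (u := u) (q := q) (R := R) g
  have hPlt : chunkStart u q R (g + 1) < 2 ^ w :=
    ((chunkStart_le hD.q_pos hD.mono _).trans_lt (hD.bound _)).trans_le hvw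
  have hqu : 0 < q * u := Nat.mul_pos hD.q_pos hD.u_pos
  have hc := chunkNum_lt (u := u) (q := q) (R := R) NG (chunkStart u q R g + δ)
  set c := chunkNum u q R NG (chunkStart u q R g + δ) with hcdef
  have hcount : fieldsBelow u q c r = min q (R (g * 2 ^ u + r) - R (g * 2 ^ u) - q * δ) :=
    fieldsBelow_chunkNum hD.mono hg hδ hr
  have hcv : fieldsBelow u q c r < 2 ^ v := (fieldsBelow_le c r).trans_lt hD.q_lt
  refine hM.fetchTo (q * u) _ (chunkStart u q R g + δ) c hD.chunks
    (by rw [e 3 (by norm_num), hE.r3]) hI.width hI.cur hqu hD.chunk_le (by omega) rfl hc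
    fun s1 h1 => ?_
  refine Runs.bind (Q' := fun s' t => t ≤ 16 ∧ ∃ E1, Models s' E1 m ∧ (∀ i, i ≠ 35 → E1 i = E' i) ∧
    E1 35 = fieldsBelow u q c r) ?_ ?_
  · by_cases ht : tbl = 0
    · have hq1 := hD.q_eq ht
      refine Runs.iteFalse ?_ ?_
      · rw [h1.val 14 (by norm_num)]; simp [e 14, hE.r14, ht]
      refine h1.lt hw (fieldsBelow u q c r) ?_ fun s2 h2 => h2.skip fun s3 h3 => ?_
      · subst hq1
        rw [fieldsBelow_one (by simpa using hc)]; simp [hI.rem]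
      · refine ⟨by norm_num, _, h3, fun i hi => by simp [hi], by simp⟩
    · have hidx : c * 2 ^ u + r < 2 ^ (q * u + u) := by
        have : (c + 1) * 2 ^ u ≤ 2 ^ (q * u) * 2 ^ u := Nat.mul_le_mul_right _ hc
        rw [add_one_mul, ← pow_add] at this
        omega
      have hidx' : 2 ^ (q * u + u) ≤ 2 ^ w :=
        Nat.pow_le_pow_right (by norm_num) (hD.table_le ht)
      refine Runs.iteTrue ?_ ?_
      · rw [h1.val 14 (by norm_num)]; simpa [e 14, hE.r14] using ht
      refine h1.shl (c * 2 ^ u) (by simp [e 7, hE.r7]) (by omega) fun s2 h2 => ?_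
      refine h2.add (c * 2 ^ u + r) (by simp [hI.rem]) (by omega) fun s3 h3 => ?_
      refine h3.fetchTo v _ (c * 2 ^ u + r) (fieldsBelow u q c r) (hD.table ht)
        (by simp [e 3, hE.r3]) (by simp [e 6, hE.r6]) (by simp) hD.v_pos hD.v_le hidx ?_ hcv
        fun s4 h4 => h4.skip fun s5 h5 => ?_
      · rw [mul_comm c, Nat.mul_add_div (by positivity), Nat.mul_add_mod, Nat.div_eq_of_lt hr,
          Nat.mod_eq_of_lt hr, add_zero]
      · exact ⟨by norm_num, _, h5, fun i hi => by simp [hi], by simp⟩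
  rintro s2 t2 ⟨ht2, E1, h2, hE1, h35⟩
  set ρ := R (g * 2 ^ u + r) - R (g * 2 ^ u) with hρdef
  have hRlt := hD.bound (g * 2 ^ u + r)
  have hR0 : R (g * 2 ^ u) ≤ R (g * 2 ^ u + r) := hD.mono (by omega)
  rw [hcount] at h35
  have hsum : R (g * 2 ^ u) + min ρ (q * δ) + min q (ρ - q * δ)
      = R (g * 2 ^ u) + min ρ (q * (δ + 1)) := by
    rw [mul_add, mul_one]; omega
  have hlt : R (g * 2 ^ u) + min ρ (q * (δ + 1)) < 2 ^ w :=
    (Nat.add_le_add_left (min_le_left _ _) _).trans_lt (by omega)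
  refine h2.add _ (by rw [hE1 24 (by norm_num), hI.acc, h35, hsum]) hlt fun s3 h3 => ?_
  refine h3.add (chunkStart u q R g + (δ + 1)) ?_ (by omega) fun s4 h4 => ?_
  · simp [hE1 30, hE1 29, hI.cur, hI.one, add_assoc]
  refine h4.eq hw (if q * (δ + 1) ≤ ρ then 1 else 0) ?_ fun s5 h5 => ?_
  · simp only [ne_eq, Nat.reduceEqDiff, not_false_eq_true, Function.update_of_ne, h35,
      hE1 13 (by norm_num), e 13 (by norm_num), hE.r13]
    refine if_congr ?_ rfl rfl
    rw [mul_add, mul_one]; omega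
  refine h5.lt hw (if δ + 1 < groupChunks u q R g then 1 else 0) ?_ fun s6 h6 => ?_
  · simp only [ne_eq, Nat.reduceEqDiff, not_false_eq_true, Function.update_of_ne,
      Function.update_self, hE1 31 (by norm_num), hI.fin, hsucc]
    exact if_congr (by omega) rfl rfl
  refine h6.and (P := q * (δ + 1) ≤ ρ) (P' := δ + 1 < groupChunks u q R g) (by simp) (by simp)
    fun s7 h7 => h7.skip fun s8 h8 => ⟨by omega, _, h8, ?_⟩
  constructor
  · intro i hi
    simp only [update_low hi, Nat.reduceLeDiff]
    rw [hE1 i (by omega), e i hi]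
  · simp [hρdef]
  · simp [hE1 26, hI.rem]
  · simp [hE1 29, hI.one]
  · simp
  · simp [hE1 31, hI.fin]
  · simp [hE1 33, hI.width]
  · simp [hρdef]
  · omega

-- The loop is controlled by the number of whole chunks below the key, plus one, less the chunks
-- already passed. Its initial value is what `chunks_inspected_le` bounds; each unit pays for one
-- chunk and one loop test.
set_option maxHeartbeats 1000000 in
theorem sparseRank_runs (hD : SparseData w v u me k q tbl NG R data) {s : State w} {E : ℕ → ℕ}
    {m : ℕ → BitVec w → BitVec w} {a y x : ℕ} (hE : HasParams w v u me k q tbl se sw E)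
    (hM : Models s E m) (ha : E 20 = a) (hy : E 21 = y) (hav : a < 2 ^ v)
    (hx : y * 2 ^ v + a = x) (hg : x / 2 ^ u < NG) :
    Runs data sparseRank s fun s' t => (∃ E', Models s' E' m ∧ (∀ i < 24, E' i = E i) ∧
      E' 24 = R x) ∧
      t ≤ 300 + 36 * ((R x - R (x / 2 ^ me * 2 ^ me)) / q
        + (R ((x / 2 ^ u + 1) * 2 ^ u) - R (x / 2 ^ u * 2 ^ u)) / (q * k)) := by
  have hw : 0 < w := hD.v_pos.trans_le hD.v_le
  have hvw : 2 ^ v ≤ 2 ^ w := Nat.pow_le_pow_right (by norm_num) hD.v_le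
  have hww : w < 2 ^ w := Nat.lt_two_pow_self
  refine hM.locate hE hD.v_le hw hD.u_le ha hy hav (by rw [hx]; exact hg.trans hD.groups_lt)
    fun s1 E1 h1 hlow h25 h26 h29 => ?_
  rw [hx] at h25 h26
  have hxgr : x / 2 ^ u * 2 ^ u + x % 2 ^ u = x := Nat.div_add_mod' x _
  have hr : x % 2 ^ u < 2 ^ u := Nat.mod_lt _ (by positivity)
  -- Blocks refine groups, so rounding the remainder to its block start is the same as rounding the
  -- whole key.
  have hme : x / 2 ^ u * 2 ^ u + x % 2 ^ u / 2 ^ me * 2 ^ me = x / 2 ^ me * 2 ^ me := by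
    have h : x / 2 ^ me = x / 2 ^ u * k + x % 2 ^ u / 2 ^ me := by
      conv_lhs => rw [← hxgr, ← hD.k_mul, ← mul_assoc, add_comm,
        Nat.add_mul_div_right _ _ (by positivity), hD.k_mul, add_comm]
    rw [h, add_mul, mul_assoc, hD.k_mul]
  set g := x / 2 ^ u with hgdef
  set r := x % 2 ^ u with hrdef
  have hPlt : ∀ g, chunkStart u q R g < 2 ^ v := fun g =>
    (chunkStart_le hD.q_pos hD.mono _).trans_lt (hD.bound _)
  have hsucc := chunkStart_succ (u := u) (q := q) (R := R) g
  have hskip := skip_le (me := me) (k := k) hD.mono hD.q_pos (g := g) hr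
  have hskipm := skip_mul_le (u := u) (me := me) (k := k) (q := q) hD.mono (g := g) (r := r)
  have ht : r / 2 ^ me < k :=
    Nat.div_lt_of_lt_mul (by rw [mul_comm, hD.k_mul]; exact hr)
  have hsk : ∀ t < k, skipCount u me k q R g t < k := fun t ht =>
    skipCount_lt hD.mono hD.k_pos hD.q_pos hD.k_mul ht
  have hun := unary_lt k (skipCount u me k q R g)
  have hdec := unaryDecode_unary (skipCount_mono (u := u) (me := me) (k := k) (q := q) hD.mono g)
    hsk ht
  set un := unary k (skipCount u me k q R g) with hundef
  set e := skipCount u me k q R g (r / 2 ^ me) with hedef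
  have hidx : un * k + r / 2 ^ me < 2 ^ (2 * k) * k := by
    have : (un + 1) * k ≤ 2 ^ (2 * k) * k := Nat.mul_le_mul_right _ hun
    rw [add_one_mul] at this
    omega
  have hR0 : R (g * 2 ^ u) ≤ R x := hD.mono (by omega)
  have hRx := hD.bound x
  have hNG := hD.groups_lt
  have hunle := hD.unary_le
  rw [hxgr] at hskipm
  refine h1.fetchTo v _ g (R (g * 2 ^ u)) hD.base (by simp [hlow, hE.r3]) (by simp [hlow, hE.r6])
    h25 hD.v_pos hD.v_le hg rfl (hD.bound _) fun s2 h2 => ?_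
  refine h2.fetchTo v _ g (chunkStart u q R g) hD.start (by simp [hlow, hE.r3])
    (by simp [hlow, hE.r6]) (by simp [h25]) hD.v_pos hD.v_le (by omega) rfl (hPlt _)
    fun s3 h3 => ?_
  refine h3.add (g + 1) (by simp [h25, h29]) (by omega) fun s4 h4 => ?_
  refine h4.fetchTo v _ (g + 1) (chunkStart u q R (g + 1)) hD.start (by simp [hlow, hE.r3])
    (by simp [hlow, hE.r6]) (by simp) hD.v_pos hD.v_le (by omega) rfl (hPlt _)
    fun s5 h5 => ?_
  refine h5.sub (groupChunks u q R g) (by simp [hsucc]) (by simp [hsucc]) fun s6 h6 => ?_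
  refine h6.div (groupChunks u q R g / k) (by simp [hlow, hE.r12]) fun s7 h7 => ?_
  -- The bounds at hand do not exclude a unit equal to `2 ^ w`. Wrapping is harmless: the unit is
  -- used only in a product that fits into a word by `skip_le`.
  refine h7.op .add (skipUnit u k q R g % 2 ^ w) (fun a b ha hb => ?_) fun s8 h8 => ?_
  · have hb' : b.toNat = 1 := by rw [hb]; simp [h29]
    have ha' : a.toNat = groupChunks u q R g / k := by rw [ha]; simp
    simp [Op.eval, ha', hb', skipUnit]
  refine h8.add (2 * k) (by simp [hlow, hE.r12, two_mul]) (hD.k_le.trans_lt hww) fun s9 h9 => ?_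
  refine h9.fetchTo (2 * k) _ g un hD.skips (by simp [hlow, hE.r3]) (by simp)
    (by simp [h25]) (Nat.mul_pos two_pos hD.k_pos) hD.k_le hg rfl hun fun s10 h10 => ?_
  refine h10.mul (un * k) (by simp [hlow, hE.r12])
    (((Nat.le_add_right _ _).trans_lt hidx).trans_le hunle) fun s11 h11 => ?_
  refine h11.shr (r / 2 ^ me) (by simp [h26, hlow, hE.r11]) fun s12 h12 => ?_
  refine h12.add (un * k + r / 2 ^ me) (by simp) (hidx.trans_le hunle) fun s13 h13 => ?_
  refine h13.fetchTo v _ (un * k + r / 2 ^ me) e hD.decode (by simp [hlow, hE.r3])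
    (by simp [hlow, hE.r6]) (by simp) hD.v_pos hD.v_le hidx ?_
    ((hsk _ ht).trans_le hD.k_lt) fun s14 h14 => ?_
  · rw [mul_comm un, Nat.mul_add_div hD.k_pos, Nat.mul_add_mod, Nat.div_eq_of_lt ht,
      Nat.mod_eq_of_lt ht, add_zero, hdec]
  have hh : groupChunks u q R g < 2 ^ w := by have := hPlt (g + 1); omega
  refine h14.op .mul (skipUnit u k q R g * e) (fun a b ha hb => ?_) fun s15 h15 => ?_
  · have hb' : b.toNat = e := by rw [hb]; simp
    have ha' : a.toNat = skipUnit u k q R g % 2 ^ w := by rw [ha]; simp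
    simp only [Op.eval, BitVec.toNat_mul, ha', hb', Nat.mod_mul_mod]
    exact Nat.mod_eq_of_lt (hskip.trans_lt hh)
  set δ := skipUnit u k q R g * e with hδdef
  refine h15.mul (q * δ) (by simp [hlow, hE.r13, mul_comm]) (by omega) fun s16 h16 => ?_
  refine h16.add (R (g * 2 ^ u) + q * δ) (by simp) (by omega) fun s17 h17 => ?_
  refine h17.add (chunkStart u q R g + δ) (by simp) (by have := hPlt (g + 1); omega)
    fun s18 h18 => ?_
  refine h18.mul (q * u) (by simp [hlow, hE.r13, hE.r7]) (hD.chunk_le.trans_lt hww)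
    fun s19 h19 => ?_
  refine h19.lt hw (if δ < groupChunks u q R g then 1 else 0) ?_ fun s20 h20 => ?_
  · simp only [ne_eq, Nat.reduceEqDiff, not_false_eq_true, Function.update_of_ne,
      Function.update_self, hsucc]
    exact if_congr (by omega) rfl rfl
  have hins : (R x - R (g * 2 ^ u)) / q + 1 - δ ≤ (R x - R (x / 2 ^ me * 2 ^ me)) / q
      + (R ((g + 1) * 2 ^ u) - R (g * 2 ^ u)) / (q * k) + 5 := by
    have h := chunks_inspected_le (u := u) (me := me) (k := k) (q := q) hD.mono hD.k_pos hD.q_pos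
      (g := g) (r := r)
    rwa [hxgr, hme] at h
  refine (Runs.loop (x := 34) (P := fun s' => ∃ E', Models s' E' m ∧ (∀ i < 24, E' i = E i) ∧
      E' 24 = R x) (fun d τ s => ∃ E' δ, Models s E' m ∧ ChunkInv v u q R E g r δ E' ∧
      d = (R x - R (g * 2 ^ u)) / q + 1 - δ ∧ τ = 36 * d + 1) ?_ ?_
      ((R x - R (g * 2 ^ u)) / q + 1 - δ) (36 * ((R x - R (g * 2 ^ u)) / q + 1 - δ) + 1)
      ⟨_, δ, h20, ?_, rfl, rfl⟩).mono ?_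
  · rintro d τ s ⟨E', δ, hM', hI, rfl, rfl⟩ hne
    rw [hM'.val 34 (by norm_num), hI.cond] at hne
    have hcond := (Ne.ite_ne_right_iff (one_ne_zero)).1 hne
    have hle : δ ≤ (R x - R (g * 2 ^ u)) / q := by
      rw [Nat.le_div_iff_mul_le hD.q_pos, mul_comm, ← hxgr]
      exact hcond.1
    refine ⟨(R x - R (g * 2 ^ u)) / q + 1 - (δ + 1),
      36 * ((R x - R (g * 2 ^ u)) / q + 1 - (δ + 1)) + 1, by omega, ?_⟩
    refine (chunkStep_runs hD hE hg hr hM' hI hcond.2 hcond.1).mono ?_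
    rintro s' t ⟨htle, E'', hM'', hI''⟩
    exact ⟨⟨E'', δ + 1, hM'', hI'', rfl, rfl⟩, by omega⟩
  · rintro d τ s ⟨E', δ, hM', hI, rfl, rfl⟩ h0
    refine ⟨by omega, E', hM', hI.low, ?_⟩
    rw [hM'.val 34 (by norm_num), hI.cond, hxgr] at h0
    rw [hI.acc, hxgr]
    have hcond : ¬ (q * δ ≤ R x - R (g * 2 ^ u) ∧ δ < groupChunks u q R g) := fun h => by
      rw [if_pos h] at h0; exact one_ne_zero h0
    rw [not_and_or] at hcond
    -- Either the chunks passed hold more places than there are keys below the query, or all chunks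
    -- of the group have been passed; in both cases the minimum in the accumulator is the full rank.
    rcases hcond with h | h
    · omega
    · have h1 : δ = groupChunks u q R g := le_antisymm hI.le (not_lt.1 h)
      have h2 := le_groupChunks (u := u) (R := R) hD.q_pos g
      have h3 : R x ≤ R ((g + 1) * 2 ^ u) := hD.mono (by rw [add_one_mul]; omega)
      rw [h1]
      omega
  · constructor
    · intro i hi
      simp only [update_low hi, Nat.reduceLeDiff]
      exact hlow i hi
    · rw [hxgr]; simp [min_eq_right hskipm]
    · simp [h26]
    · simp [h29]
    · simp
    · simp
    · simp
    · rw [hxgr]; simp [hskipm]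
    · exact hskip
  · rintro s' t ⟨hP, htle⟩
    refine ⟨hP, ?_⟩
    generalize (R x - R (x / 2 ^ me * 2 ^ me)) / q = A at *
    generalize (R ((g + 1) * 2 ^ u) - R (g * 2 ^ u)) / (q * k) = B at *
    generalize (R x - R (g * 2 ^ u)) / q + 1 - δ = F at *
    clear * - htle hins
    linarith

end Sparse

end WordRAM

/-! ### Ranking in constant time for small alphabets -/

/-- The number of the first `o` fields of `c` that are equal to `y`. -/
def fieldsEqual (u c y o : ℕ) : ℕ :=
  ((Finset.range o).filter fun j => c / 2 ^ (u * j) % 2 ^ u = y).card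

namespace WordRAM

/-- Rank a key with the help of explicit ranks of blocks and of a table for text blocks. -/
def denseRank : Prog 23 :=
  locate <|
  .seq (fetchTo 14 24 25 6) <| .seq (.op .shl 35 21 17) <| .seq (.op .shr 30 20 15) <|
  .seq (.op .add 35 35 30) <| .seq (fetchTo 20 35 35 7) <| .seq (.op .add 24 24 35) <|
  .seq (.op .shl 33 16 15) <| .seq (fetchTo 21 35 30 33) <| .seq (.op .shl 35 35 16) <|
  .seq (.op .add 35 35 21) <| .seq (.op .shl 35 35 15) <| .seq (.op .shl 31 29 15) <|
  .seq (.op .mod 31 20 31) <| .seq (.op .add 35 35 31) <| .seq (fetchTo 22 35 35 6) <|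
  .seq (.op .add 24 24 35) .skip

/-- The data arrays and the parameters of the structure for small alphabets; the text is `T`. -/
structure DenseData (w v u se sw NG NB NT n : ℕ) (R T : ℕ → ℕ)
    (data : Fin 23 → BitVec w → BitVec w) : Prop where
  mono : Monotone R
  bound : ∀ x, R x < 2 ^ v
  lip : ∀ x d, R (x + d) ≤ R x + d
  v_pos : 0 < v
  v_le : v ≤ w
  u_pos : 0 < u
  u_le : u ≤ w
  se_le_v : se ≤ v
  se_le_u : se ≤ u
  sw_pos : 0 < sw
  table_le : sw * 2 ^ se + sw + se ≤ w
  groups_lt : NG < 2 ^ w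
  blocks_lt : NB ≤ 2 ^ w
  text : ∀ p, T p < 2 ^ sw
  block : ∀ y a, a ≤ n → R (y * 2 ^ v + a) = R (y * 2 ^ v + a / 2 ^ se * 2 ^ se)
    + ((Finset.range (a % 2 ^ se)).filter fun j => T (a / 2 ^ se * 2 ^ se + j) = y).card
  base : data 14 = packBits w (fieldList w v NG fun g => R (g * 2 ^ u))
  blocks : data 20 = packBits w (fieldList w u NB fun b =>
    R (b * 2 ^ se) - R (b * 2 ^ se / 2 ^ u * 2 ^ u))
  texts : data 21 = packBits w (fieldList w (sw * 2 ^ se) NT fun c =>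
    packNat sw (2 ^ se) fun j => T (c * 2 ^ se + j))
  table : data 22 = packBits w (fieldList w v (2 ^ (sw * 2 ^ se + sw + se)) fun i =>
    fieldsEqual sw (i / 2 ^ se / 2 ^ sw) (i / 2 ^ se % 2 ^ sw) (i % 2 ^ se))

/-- The rank is a sum of three stored numbers: the rank of the group start, the increase up to the
block start, and the occurrences of the symbol in the text block before the position. -/
theorem denseRank_runs {w v u me k q tbl NG NB NT n se sw : ℕ} {R T : ℕ → ℕ}
    {data : Fin 23 → BitVec w → BitVec w} (hD : DenseData w v u se sw NG NB NT n R T data)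
    {s : State w} {E : ℕ → ℕ} {m : ℕ → BitVec w → BitVec w} {a y x : ℕ}
    (hE : HasParams w v u me k q tbl se sw E) (hM : Models s E m) (ha : E 20 = a) (hy : E 21 = y)
    (hav : a < 2 ^ v) (han : a ≤ n) (hysw : y < 2 ^ sw) (hx : y * 2 ^ v + a = x) (hg : x / 2 ^ u < NG)
    (hb : x / 2 ^ se < NB) (hT : a / 2 ^ se < NT) :
    Runs data denseRank s fun s' t => (∃ E', Models s' E' m ∧ (∀ i < 24, E' i = E i) ∧
      E' 24 = R x) ∧ t ≤ 300 := by
  have hw : 0 < w := hD.v_pos.trans_le hD.v_le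
  have hvw : 2 ^ v ≤ 2 ^ w := Nat.pow_le_pow_right (by norm_num) hD.v_le
  have hww : w < 2 ^ w := Nat.lt_two_pow_self
  refine hM.locate hE hD.v_le hw hD.u_le ha hy hav (by rw [hx]; exact hg.trans hD.groups_lt)
    fun s1 E1 h1 hlow h25 h26 h29 => ?_
  rw [hx] at h25 h26
  have hxb : y * 2 ^ (v - se) + a / 2 ^ se = x / 2 ^ se := by
    have h := div_two_pow_eq (u := se) (y := y) hav
    rw [Nat.sub_eq_zero_of_le hD.se_le_v, pow_zero, Nat.div_one, Nat.min_eq_left hD.se_le_v, hx]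
      at h
    exact h
  have hxb' : x / 2 ^ se * 2 ^ se = y * 2 ^ v + a / 2 ^ se * 2 ^ se := by
    rw [← hxb, add_mul, mul_assoc, ← pow_add, Nat.sub_add_cancel hD.se_le_v]
  -- Since `se ≤ u`, a block never crosses a group boundary.
  have hgrp : x / 2 ^ se * 2 ^ se / 2 ^ u = x / 2 ^ u := by
    obtain ⟨d, rfl⟩ := Nat.exists_eq_add_of_le hD.se_le_u
    rw [pow_add, ← Nat.div_div_eq_div_mul, Nat.mul_div_cancel _ (by positivity),
      Nat.div_div_eq_div_mul]
  have ho : a % 2 ^ se < 2 ^ se := Nat.mod_lt _ (by positivity)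
  have hblock := hD.block y a han
  rw [hx, ← hxb'] at hblock
  have hlo : R (x / 2 ^ u * 2 ^ u) ≤ R (x / 2 ^ se * 2 ^ se) := hD.mono (by
    rw [← hgrp]; exact Nat.div_mul_le_self _ _)
  -- The rank grows by at most one per key value, so increases within a group fit into `u` bits.
  have hdiff : R (x / 2 ^ se * 2 ^ se) - R (x / 2 ^ u * 2 ^ u) < 2 ^ u := by
    have h1 := hD.lip (x / 2 ^ u * 2 ^ u) (x / 2 ^ se * 2 ^ se % 2 ^ u)
    have h2 : x / 2 ^ u * 2 ^ u + x / 2 ^ se * 2 ^ se % 2 ^ u = x / 2 ^ se * 2 ^ se := by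
      rw [← hgrp]; exact Nat.div_add_mod' _ _
    have h3 : x / 2 ^ se * 2 ^ se % 2 ^ u < 2 ^ u := Nat.mod_lt _ (by positivity)
    rw [h2] at h1
    omega
  have hRx := hD.bound x
  have hc : packNat sw (2 ^ se) (fun j => T (a / 2 ^ se * 2 ^ se + j)) < 2 ^ (sw * 2 ^ se) :=
    packNat_lt fun j => hD.text _
  have hcount : fieldsEqual sw (packNat sw (2 ^ se) (fun j => T (a / 2 ^ se * 2 ^ se + j))) y
      (a % 2 ^ se)
      = ((Finset.range (a % 2 ^ se)).filter fun j => T (a / 2 ^ se * 2 ^ se + j) = y).card := by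
    refine congrArg Finset.card (Finset.filter_congr fun j hj => ?_)
    rw [packNat_field (fun j => hD.text _) ((Finset.mem_range.1 hj).trans ho)]
  set c := packNat sw (2 ^ se) (fun j => T (a / 2 ^ se * 2 ^ se + j))
  rw [← hcount] at hblock
  have hidx1 : c * 2 ^ sw + y < 2 ^ (sw * 2 ^ se + sw) := by
    have : (c + 1) * 2 ^ sw ≤ 2 ^ (sw * 2 ^ se) * 2 ^ sw := Nat.mul_le_mul_right _ hc
    rw [add_one_mul, ← pow_add] at this
    omega
  have hidx : (c * 2 ^ sw + y) * 2 ^ se + a % 2 ^ se < 2 ^ (sw * 2 ^ se + sw + se) := by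
    have : (c * 2 ^ sw + y + 1) * 2 ^ se ≤ 2 ^ (sw * 2 ^ se + sw) * 2 ^ se :=
      Nat.mul_le_mul_right _ hidx1
    rw [add_one_mul, ← pow_add] at this
    omega
  have hidxw : (c * 2 ^ sw + y) * 2 ^ se + a % 2 ^ se < 2 ^ w :=
    hidx.trans_le (Nat.pow_le_pow_right (by norm_num) hD.table_le)
  have hidxw1 : c * 2 ^ sw + y < 2 ^ w :=
    hidx1.trans_le (Nat.pow_le_pow_right (by norm_num) (by have := hD.table_le; omega))
  have hsww : sw * 2 ^ se ≤ w := by have := hD.table_le; omega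
  have hbw : x / 2 ^ se < 2 ^ w := hb.trans_le hD.blocks_lt
  refine h1.fetchTo v _ (x / 2 ^ u) (R (x / 2 ^ u * 2 ^ u)) hD.base (by simp [hlow, hE.r3])
    (by simp [hlow, hE.r6]) h25 hD.v_pos hD.v_le hg rfl (hD.bound _) fun s2 h2 => ?_
  refine h2.shl (y * 2 ^ (v - se)) (by simp [hlow, hy, hE.r17])
    ((Nat.le_add_right _ _).trans_lt (hxb.trans_lt hbw)) fun s3 h3 => ?_
  refine h3.shr (a / 2 ^ se) (by simp [hlow, ha, hE.r15]) fun s4 h4 => ?_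
  refine h4.add (x / 2 ^ se) (by simp [hxb]) hbw fun s5 h5 => ?_
  refine h5.fetchTo u _ (x / 2 ^ se) _ hD.blocks (by simp [hlow, hE.r3])
    (by simp [hlow, hE.r7]) (by simp) hD.u_pos hD.u_le hb rfl (by rw [hgrp]; exact hdiff)
    fun s6 h6 => ?_
  rw [hgrp] at h6
  refine h6.add (R (x / 2 ^ se * 2 ^ se)) (by simp [hlo]) (by omega) fun s7 h7 => ?_
  refine h7.shl (sw * 2 ^ se) (by simp [hlow, hE.r15, hE.r16]) (hsww.trans_lt hww)
    fun s8 h8 => ?_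
  refine h8.fetchTo (sw * 2 ^ se) _ (a / 2 ^ se) c hD.texts (by simp [hlow, hE.r3]) (by simp)
    (by simp) (Nat.mul_pos hD.sw_pos (by positivity)) hsww hT rfl hc fun s9 h9 => ?_
  refine h9.shl (c * 2 ^ sw) (by simp [hlow, hE.r16])
    ((Nat.le_add_right _ _).trans_lt hidxw1) fun s10 h10 => ?_
  refine h10.add (c * 2 ^ sw + y) (by simp [hlow, hy]) hidxw1 fun s11 h11 => ?_
  refine h11.shl ((c * 2 ^ sw + y) * 2 ^ se) (by simp [hlow, hE.r15])
    ((Nat.le_add_right _ _).trans_lt hidxw) fun s12 h12 => ?_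
  refine h12.modPow (a % 2 ^ se) se (by simp [h29]) (by simp [hlow, hE.r15])
    (hD.se_le_u.trans hD.u_le) (by simp [hlow, ha]) (by norm_num) fun s13 h13 => ?_
  refine h13.add ((c * 2 ^ sw + y) * 2 ^ se + a % 2 ^ se) (by simp) hidxw fun s14 h14 => ?_
  refine h14.fetchTo v _ ((c * 2 ^ sw + y) * 2 ^ se + a % 2 ^ se)
    (fieldsEqual sw c y (a % 2 ^ se)) hD.table (by simp [hlow, hE.r3]) (by simp [hlow, hE.r6])
    (by simp) hD.v_pos hD.v_le hidx ?_ (by omega) fun s15 h15 => ?_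
  · have e1 : ((c * 2 ^ sw + y) * 2 ^ se + a % 2 ^ se) / 2 ^ se = c * 2 ^ sw + y := by
      rw [mul_comm, Nat.mul_add_div (by positivity), Nat.div_eq_of_lt ho, add_zero]
    have e2 : ((c * 2 ^ sw + y) * 2 ^ se + a % 2 ^ se) % 2 ^ se = a % 2 ^ se := by
      rw [Nat.mul_add_mod', Nat.mod_eq_of_lt ho]
    have e3 : (c * 2 ^ sw + y) / 2 ^ sw = c := by
      rw [mul_comm, Nat.mul_add_div (by positivity), Nat.div_eq_of_lt hysw, add_zero]
    have e4 : (c * 2 ^ sw + y) % 2 ^ sw = y := by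
      rw [Nat.mul_add_mod', Nat.mod_eq_of_lt hysw]
    rw [e1, e2, e3, e4]
  refine h15.add (R x) (by simp [hblock]) (by omega) fun s16 h16 => h16.skip fun s17 h17 => ?_
  refine ⟨⟨_, h17, fun i hi => ?_, by simp⟩, by norm_num⟩
  simp only [update_low hi, Nat.reduceLeDiff]
  exact hlow i hi

/-! ### The query program -/

/-- Rank the key with position in register `20` and symbol in register `21`. -/
def rankProg : Prog 23 :=
  .ite 4 (.ite 5 denseRank sparseRank) (.seq (copy 24 20) .skip)

/-- Answer the query for one symbol. -/
def answerStep : Prog 23 :=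
  .seq (.load 21 0 18) <| .seq (.const 25 1) <| .seq (.op .sub 21 21 25) <|
  .seq (.op .sub 20 0 25) <| .seq rankProg <| .seq (copy 22 24) <| .seq (copy 20 1) <|
  .seq rankProg <| .seq (.op .sub 24 24 22) <| .seq (.store 1 18 24) <| .seq (.const 25 1) <|
  .seq (.op .add 18 18 25) <| .seq (.op .lt 19 18 2) .skip

/-- Load the parameters of the data structure, and answer the query for all symbols. -/
def queryProg : Prog 23 :=
  .seq (.const 24 0) <|
  .seq (.read 4 0 24) <| .seq (.read 5 1 24) <| .seq (.read 6 2 24) <| .seq (.read 7 3 24) <|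
  .seq (.read 8 4 24) <| .seq (.read 9 5 24) <| .seq (.read 10 6 24) <| .seq (.read 11 7 24) <|
  .seq (.read 12 8 24) <| .seq (.read 13 9 24) <| .seq (.read 14 10 24) <|
  .seq (.read 15 11 24) <| .seq (.read 16 12 24) <| .seq (.read 17 13 24) <|
  .seq (.const 18 0) <| .seq (.op .lt 19 18 2) (.loop 19 answerStep)

/-- With parameters `par`, `rankProg` computes `ρ y a` in at most `cost y a` steps. -/
def Ranks {w : ℕ} (data : Fin 23 → BitVec w → BitVec w) (par : ℕ → ℕ) (n σ : ℕ)
    (ρ cost : ℕ → ℕ → ℕ) : Prop :=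
  ∀ (s : State w) (E : ℕ → ℕ) (m : ℕ → BitVec w → BitVec w) (a y : ℕ), Models s E m →
    E 3 = w → (∀ i < 14, E (4 + i) = par i) → E 20 = a → E 21 = y → a ≤ n → y < σ →
    Runs data rankProg s fun s' t => (∃ E', Models s' E' m ∧ (∀ i < 24, E' i = E i) ∧
      E' 24 = ρ y a) ∧ t ≤ cost y a

section Main

variable {w n σ : ℕ} {data : Fin 23 → BitVec w → BitVec w} {par : ℕ → ℕ} {ρ cost : ℕ → ℕ → ℕ}
  {S : ℕ → ℕ} {i j : ℕ} {Y : List ℕ}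

/-- The state after the answers for the first `d` symbols. -/
structure AnswerInv (par : ℕ → ℕ) (S : ℕ → ℕ) (i j : ℕ) (Y : List ℕ) (d : ℕ) (E : ℕ → ℕ)
    (m : ℕ → BitVec w → BitVec w) : Prop where
  left : E 0 = i
  right : E 1 = j
  size : E 2 = Y.length
  wordSize : E 3 = w
  par : ∀ i < 14, E (4 + i) = par i
  count : E 18 = d
  cond : E 19 = if d < Y.length then 1 else 0
  symbols : ∀ (q : ℕ) (hq : q < Y.length), m 0 (BitVec.ofNat w q) = BitVec.ofNat w Y[q]
  answers : ∀ (q : ℕ) (hq : q < Y.length), q < d →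
    m 1 (BitVec.ofNat w q) = BitVec.ofNat w (rangeFreq S i j Y[q])

theorem answerStep_runs (hσ : σ < 2 ^ w) (hw : 0 < w)
    (hR : Ranks data par n σ ρ cost)
    (hfreq : ∀ y < σ, ρ y (i - 1) + rangeFreq S i j (y + 1) = ρ y j)
    (hi : 1 ≤ i) (hij : i ≤ j) (hj : j ≤ n) (hY : ∀ y ∈ Y, y ∈ Finset.Icc 1 σ)
    (hYw : Y.length < 2 ^ w) {d : ℕ} (hd : d < Y.length) {s : State w} {E : ℕ → ℕ}
    {m : ℕ → BitVec w → BitVec w} (hM : Models s E m) (hI : AnswerInv par S i j Y d E m) :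
    Runs data answerStep s fun s' t => (∃ E' m', Models s' E' m' ∧
      AnswerInv par S i j Y (d + 1) E' m') ∧
      t ≤ 12 + cost (Y[d] - 1) (i - 1) + cost (Y[d] - 1) j := by
  have h1w : 1 < 2 ^ w := Nat.one_lt_two_pow hw.ne'
  obtain ⟨hy1, hyσ⟩ := Finset.mem_Icc.1 (hY _ (List.getElem_mem hd))
  have hofNat : ∀ {a : BitVec w} {x : ℕ}, a.toNat = x → a = BitVec.ofNat w x := fun h => by
    subst h; simp
  refine hM.load Y[d] (fun a ha => ?_) fun s1 h1 => ?_
  · rw [hofNat (ha.trans hI.count), hI.symbols d hd]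
    exact State.val_const (by omega)
  refine h1.const h1w fun s2 h2 => ?_
  refine h2.sub (Y[d] - 1) (by simp) (by simpa using hy1) fun s3 h3 => ?_
  refine h3.sub (i - 1) (by simp [hI.left]) (by simpa [hI.left] using hi) fun s4 h4 => ?_
  refine Runs.bind (hR s4 _ m (i - 1) (Y[d] - 1) h4 (by simp [hI.wordSize]) (fun x hx => ?_)
    (by simp) (by simp) (by omega) (by omega)) ?_
  · simp only [update_low (show 4 + x < 18 by omega), Nat.reduceLeDiff]
    exact hI.par x hx
  rintro s5 t5 ⟨⟨E5, h5, hE5, h24⟩, ht5⟩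
  refine h5.copy (ρ (Y[d] - 1) (i - 1)) h24 fun s6 h6 => ?_
  refine h6.copy j (by simp [hE5, hI.right]) fun s7 h7 => ?_
  refine Runs.bind (hR s7 _ m j (Y[d] - 1) h7 (by simp [hE5, hI.wordSize]) (fun x hx => ?_)
    (by simp) (by simp [hE5]) hj (by omega)) ?_
  · simp only [update_low (show 4 + x < 18 by omega), Nat.reduceLeDiff]
    rw [hE5 _ (by omega)]
    simp only [update_low (show 4 + x < 18 by omega), Nat.reduceLeDiff]
    exact hI.par x hx
  rintro s8 t8 ⟨⟨E8, h8, hE8, h24'⟩, ht8⟩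
  have hf := hfreq (Y[d] - 1) (by omega)
  rw [Nat.sub_add_cancel hy1] at hf
  refine h8.sub (rangeFreq S i j Y[d]) (by rw [h24', hE8 22 (by norm_num)]; simp; omega)
    (by rw [h24', hE8 22 (by norm_num)]; simp; omega) fun s9 h9 => ?_
  refine h9.store fun s10 h10 => ?_
  refine h10.const h1w fun s11 h11 => ?_
  have e := fun x (hx : x < 20) => (hE8 x (by omega)).trans (update_low hx (by norm_num))
  have e18 : E8 18 = d := by rw [e 18 (by norm_num)]; simp [hE5, hI.count]
  have elow : ∀ x < 20, E8 x = E x := fun x hx => by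
    rw [e x hx, update_low hx (by norm_num), hE5 x (by omega)]
    simp only [update_low hx, Nat.reduceLeDiff]
  refine h11.add (d + 1) (by simp [e18]) (by omega) fun s12 h12 => ?_
  refine h12.lt hw (if d + 1 < Y.length then 1 else 0) (by simp [elow, hI.size]) fun s13 h13 =>
    h13.skip fun s14 h14 => ⟨⟨_, _, h14, ?_⟩, by omega⟩
  constructor
  · simp [elow, hI.left]
  · simp [elow, hI.right]
  · simp [elow, hI.size]
  · simp [elow, hI.wordSize]
  · intro x hx
    simp only [update_low (show 4 + x < 18 by omega), Nat.reduceLeDiff]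
    rw [elow _ (by omega), hI.par x hx]
  · simp
  · simp
  · intro q hq
    rw [Function.update_of_ne (by norm_num)]
    exact hI.symbols q hq
  · intro q hq hqd
    have e18' : Function.update E8 24 (rangeFreq S i j Y[d]) 18 = d := by simp [e18]
    rw [Function.update_self, e18', Function.update_self]
    -- Indices below `2 ^ w` name distinct cells, so earlier answers are not overwritten.
    by_cases h : q = d
    · subst h; rw [Function.update_self]
    · rw [Function.update_of_ne]
      · exact hI.answers q hq (by omega)
      · intro h'
        have := congrArg BitVec.toNat h'
        rw [State.val_const (by omega), State.val_const (by omega)] at this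
        exact h this

theorem queryProg_runs (hn : n < 2 ^ w) (hσ : σ < 2 ^ w) (hw : 0 < w)
    (hpar : ∀ (x : Fin 23) (a : BitVec w), x.val < 14 → a.toNat = 0 → (data x a).toNat = par x)
    (hR : Ranks data par n σ ρ cost)
    (hfreq : ∀ y < σ, ρ y (i - 1) + rangeFreq S i j (y + 1) = ρ y j)
    (hi : 1 ≤ i) (hij : i ≤ j) (hj : j ≤ n) (hYn : Y.Nodup) (hY : ∀ y ∈ Y, y ∈ Finset.Icc 1 σ)
    {s : State w} (hs : IsFreqQuery i j Y s) :
    ∃ s' t, Exec data queryProg s s' t ∧ HasFreqAnswers S i j Y s' ∧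
      t ≤ 18 + (Y.map fun y => 13 + cost (y - 1) (i - 1) + cost (y - 1) j).sum := by
  have h1w : 1 < 2 ^ w := Nat.one_lt_two_pow hw.ne'
  -- The symbols are distinct, so their number is below `2 ^ w` and every index fits into a word.
  have hlen : Y.length ≤ σ := by
    have h1 : Y.toFinset ⊆ Finset.Icc 1 σ := fun y hy => hY y (List.mem_toFinset.1 hy)
    have h2 := Finset.card_le_card h1
    rw [List.toFinset_card_of_nodup hYn, Nat.card_Icc] at h2
    omega
  have hYw : Y.length < 2 ^ w := by omega
  have hval : ∀ {x c}, s.reg x = BitVec.ofNat w c → c < 2 ^ w → s.val x = c := fun h hc => by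
    rw [State.val, h, State.val_const hc]
  have v0 := hval hs.left (by omega)
  have v1 := hval hs.right (by omega)
  have v2 := hval hs.size hYw
  have v3 := hval hs.wordSize Nat.lt_two_pow_self
  have hM : Models s s.val s.mem := ⟨fun _ _ => rfl, rfl⟩
  suffices h : Runs data queryProg s fun s' t => HasFreqAnswers S i j Y s' ∧
      t ≤ 18 + (Y.map fun y => 13 + cost (y - 1) (i - 1) + cost (y - 1) j).sum by
    obtain ⟨s', t, h1, h2, h3⟩ := h
    exact ⟨s', t, h1, h2, h3⟩
  refine hM.const (by omega) fun s0 h0 => ?_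
  refine h0.read (par 0) (fun a ha => hpar 0 a (by norm_num) (by simpa using ha)) fun s1 h1 => ?_
  refine h1.read (par 1) (fun a ha => hpar 1 a (by norm_num) (by simpa using ha)) fun s2 h2 => ?_
  refine h2.read (par 2) (fun a ha => hpar 2 a (by norm_num) (by simpa using ha)) fun s3 h3 => ?_
  refine h3.read (par 3) (fun a ha => hpar 3 a (by norm_num) (by simpa using ha)) fun s4 h4 => ?_
  refine h4.read (par 4) (fun a ha => hpar 4 a (by norm_num) (by simpa using ha)) fun s5 h5 => ?_
  refine h5.read (par 5) (fun a ha => hpar 5 a (by norm_num) (by simpa using ha)) fun s6 h6 => ?_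
  refine h6.read (par 6) (fun a ha => hpar 6 a (by norm_num) (by simpa using ha)) fun s7 h7 => ?_
  refine h7.read (par 7) (fun a ha => hpar 7 a (by norm_num) (by simpa using ha)) fun s8 h8 => ?_
  refine h8.read (par 8) (fun a ha => hpar 8 a (by norm_num) (by simpa using ha)) fun s9 h9 => ?_
  refine h9.read (par 9) (fun a ha => hpar 9 a (by norm_num) (by simpa using ha)) fun t1 g1 => ?_
  refine g1.read (par 10) (fun a ha => hpar 10 a (by decide) (by simpa using ha)) fun t2 g2 => ?_
  refine g2.read (par 11) (fun a ha => hpar 11 a (by decide) (by simpa using ha)) fun t3 g3 => ?_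
  refine g3.read (par 12) (fun a ha => hpar 12 a (by decide) (by simpa using ha)) fun t4 g4 => ?_
  refine g4.read (par 13) (fun a ha => hpar 13 a (by decide) (by simpa using ha)) fun t5 g5 => ?_
  refine g5.const (by omega) fun t6 g6 => ?_
  refine g6.lt hw (if 0 < Y.length then 1 else 0) (by simp [v2]) fun t7 g7 => ?_
  -- The budget is the cost of the symbols still to be answered; the `13` is the overhead `12` of
  -- `answerStep_runs` plus one loop test.
  refine (Runs.loop (x := 19) (P := HasFreqAnswers S i j Y) (fun D τ s => ∃ d E m, d ≤ Y.length ∧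
      Models s E m ∧ AnswerInv par S i j Y d E m ∧ D = Y.length - d ∧
      τ = 1 + ((Y.drop d).map fun y => 13 + cost (y - 1) (i - 1) + cost (y - 1) j).sum) ?_ ?_
      Y.length (1 + (Y.map fun y => 13 + cost (y - 1) (i - 1) + cost (y - 1) j).sum)
      ⟨0, _, _, Nat.zero_le _, g7, ?_, rfl, rfl⟩).mono fun s' t ht => ⟨ht.1, by linarith [ht.2]⟩
  · rintro D τ s ⟨d, E, m, hd, hM, hI, rfl, rfl⟩ hne
    rw [hM.val 19 (by norm_num), hI.cond] at hne
    have hd : d < Y.length := (Ne.ite_ne_right_iff one_ne_zero).1 hne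
    refine ⟨Y.length - (d + 1),
      1 + ((Y.drop (d + 1)).map fun y => 13 + cost (y - 1) (i - 1) + cost (y - 1) j).sum,
      by omega, (answerStep_runs hσ hw hR hfreq hi hij hj hY hYw
      hd hM hI).mono ?_⟩
    rintro s' t ⟨⟨E', m', hM', hI'⟩, ht⟩
    refine ⟨⟨d + 1, E', m', hd, hM', hI', rfl, rfl⟩, ?_⟩
    rw [List.drop_eq_getElem_cons hd, List.map_cons, List.sum_cons]
    omega
  · rintro D τ s ⟨d, E, m, hd, hM, hI, rfl, rfl⟩ h0
    rw [hM.val 19 (by norm_num), hI.cond] at h0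
    have hd' : ¬ d < Y.length := fun h => by rw [if_pos h] at h0; exact one_ne_zero h0
    refine ⟨by omega, fun q hq => ?_⟩
    rw [hM.mem]
    exact hI.answers q hq (by omega)
  · constructor
    · simp [v0]
    · simp [v1]
    · simp [v2]
    · simp [v3]
    · intro x hx
      interval_cases x <;> simp
    · simp
    · simp
    · exact hs.symbols
    · intro q _ hq
      omega

end Main

end WordRAM

/-! ### Ranks of the pairs of a symbol and a position -/

section KeyRank

/-- The pair of the symbol at position `p` and of the position as one number. -/
def key (S : ℕ → ℕ) (v p : ℕ) : ℕ := (S p - 1) * 2 ^ v + (p - 1)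

/-- The number of positions with key less than `x`. -/
def keyRank (S : ℕ → ℕ) (v n x : ℕ) : ℕ := ((Finset.Icc 1 n).filter fun p => key S v p < x).card

variable {S : ℕ → ℕ} {v n : ℕ}

theorem keyRank_mono : Monotone (keyRank S v n) := fun _ _ h =>
  Finset.card_le_card fun _ hp => Finset.mem_filter.2
    ⟨(Finset.mem_filter.1 hp).1, (Finset.mem_filter.1 hp).2.trans_le h⟩

theorem keyRank_le (x : ℕ) : keyRank S v n x ≤ n := by
  refine (Finset.card_filter_le _ _).trans ?_
  simp

theorem keyRank_sub (lo hi : ℕ) : keyRank S v n hi - keyRank S v n lo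
    ≤ ((Finset.Icc 1 n).filter fun p => lo ≤ key S v p ∧ key S v p < hi).card := by
  rw [tsub_le_iff_left]
  refine le_trans (Finset.card_le_card fun p hp => ?_) (Finset.card_union_le _ _)
  simp only [Finset.mem_filter, Finset.mem_union] at hp ⊢
  by_cases h : key S v p < lo
  · exact Or.inl ⟨hp.1, h⟩
  · exact Or.inr ⟨hp.1, not_lt.1 h, hp.2⟩

theorem mul_two_pow_add_inj {y y' b b' : ℕ} (hb : b < 2 ^ v) (hb' : b' < 2 ^ v)
    (h : y * 2 ^ v + b = y' * 2 ^ v + b') : y = y' ∧ b = b' := by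
  have h1 := congrArg (· / 2 ^ v) h
  have h2 := congrArg (· % 2 ^ v) h
  simp only [Nat.mul_add_mod', Nat.mod_eq_of_lt hb, Nat.mod_eq_of_lt hb'] at h2
  simp only [mul_comm _ (2 ^ v), Nat.mul_add_div (Nat.two_pow_pos v), Nat.div_eq_of_lt hb,
    Nat.div_eq_of_lt hb', add_zero] at h1
  exact ⟨h1, h2⟩

/-- Intervals of keys near the points `y * 2 ^ v + a`, for different symbols `y`, contain few
keys in total. -/
theorem sum_keyRank_sub_le (hn : n < 2 ^ v) (a c d : ℕ) (Ys : Finset ℕ) (lo hi : ℕ → ℕ)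
    (hhi : ∀ y, hi y ≤ y * 2 ^ v + a + c) (hlo : ∀ y, y * 2 ^ v + a < lo y + d) :
    ∑ y ∈ Ys, (keyRank S v n (hi y) - keyRank S v n (lo y)) ≤ c + d := by
  refine (Finset.sum_le_sum fun y _ => keyRank_sub (lo y) (hi y)).trans ?_
  rw [← Finset.card_sigma, ← Finset.card_range (c + d)]
  -- A pair of symbol and position is sent to the distance of its key from the right end of the
  -- window. Modulo `2 ^ v` this distance determines the position, and then the symbol.
  refine Finset.card_le_card_of_injOn (fun z => z.1 * 2 ^ v + a + c - key S v z.2) ?_ ?_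
  · rintro ⟨y, p⟩ hz
    simp only [Finset.coe_sigma, Set.mem_sigma_iff, Finset.mem_coe, Finset.mem_filter] at hz
    have := hhi y
    have := hlo y
    simp only [Finset.coe_range, Set.mem_Iio]
    omega
  · rintro ⟨y, p⟩ hz ⟨y', p'⟩ hz' h
    simp only [Finset.coe_sigma, Set.mem_sigma_iff, Finset.mem_coe, Finset.mem_filter,
      Finset.mem_Icc] at hz hz'
    have h1 := hhi y
    have h2 := hhi y'
    simp only [key] at *
    have h3 : (y + (S p' - 1)) * 2 ^ v + (p' - 1) = (y' + (S p - 1)) * 2 ^ v + (p - 1) := by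
      rw [add_mul, add_mul]; omega
    obtain ⟨h4, h5⟩ := mul_two_pow_add_inj (by omega) (by omega) h3
    have h6 : p = p' := by omega
    subst h6
    have h7 : y = y' := by omega
    subst h7
    rfl

/-- The low `v` bits of a key give back the position, so keys are distinct and an interval of `d`
values contains at most `d` of them. -/
theorem keyRank_lip (hn : n < 2 ^ v) (x d : ℕ) :
    keyRank S v n (x + d) ≤ keyRank S v n x + d := by
  rw [← tsub_le_iff_left]
  refine (keyRank_sub x (x + d)).trans ?_
  have hd : (Finset.Ico x (x + d)).card = d := by simp
  rw [← hd]
  refine Finset.card_le_card_of_injOn (key S v) (fun p hp => ?_) fun p hp p' hp' h => ?_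
  · simpa using (Finset.mem_filter.1 hp).2
  · simp only [Finset.coe_filter, Finset.mem_Icc, Set.mem_ofPred_eq] at hp hp'
    have := (mul_two_pow_add_inj (by omega) (by omega) h).2
    omega

/-- As `b ≤ n < 2 ^ v`, keys between the two points all have symbol part `y`, which encodes the
symbol `y + 1`; position parts in `[a, b)` are positions in `(a, b]`. -/
theorem keyRank_add (hn : n < 2 ^ v) (hS : ∀ p ∈ Finset.Icc 1 n, 1 ≤ S p) {a b : ℕ} (y : ℕ)
    (hab : a ≤ b) (hb : b ≤ n) : keyRank S v n (y * 2 ^ v + b)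
      = keyRank S v n (y * 2 ^ v + a) + ((Finset.Ioc a b).filter fun p => S p = y + 1).card := by
  unfold keyRank
  rw [← Finset.card_union_of_disjoint]
  · congr 1
    ext p
    simp only [Finset.mem_filter, Finset.mem_union, Finset.mem_Ioc, Finset.mem_Icc]
    simp only [key]
    constructor
    · rintro ⟨hp, h⟩
      by_cases h1 : (S p - 1) * 2 ^ v + (p - 1) < y * 2 ^ v + a
      · exact Or.inl ⟨hp, h1⟩
      · have hSp := hS p (Finset.mem_Icc.2 hp)
        rcases lt_trichotomy (S p - 1) y with h2 | h2 | h2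
        · have := Nat.mul_le_mul_right (2 ^ v) h2
          rw [Nat.succ_mul] at this
          omega
        · rw [h2] at h h1
          omega
        · have := Nat.mul_le_mul_right (2 ^ v) h2
          rw [Nat.succ_mul] at this
          omega
    · rintro (⟨hp, h⟩ | ⟨hp, h⟩)
      · exact ⟨hp, by omega⟩
      · rw [h, Nat.add_sub_cancel]
        omega
  · rw [Finset.disjoint_left]
    intro p hp hp'
    simp only [Finset.mem_filter, Finset.mem_Ioc] at hp hp'
    simp only [key] at hp
    rw [hp'.2, Nat.add_sub_cancel] at hp
    omega

theorem keyRank_add_rangeFreq (hn : n < 2 ^ v) (hS : ∀ p ∈ Finset.Icc 1 n, 1 ≤ S p) {i j : ℕ}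
    (y : ℕ) (hi : 1 ≤ i) (hij : i ≤ j) (hj : j ≤ n) :
    keyRank S v n (y * 2 ^ v + (i - 1)) + rangeFreq S i j (y + 1)
      = keyRank S v n (y * 2 ^ v + j) := by
  rw [keyRank_add hn hS y (show i - 1 ≤ j by omega) hj, rangeFreq]
  congr 3
  ext p
  simp only [Finset.mem_Icc, Finset.mem_Ioc]
  omega

theorem keyRank_block (hn : n < 2 ^ v) (hS : ∀ p ∈ Finset.Icc 1 n, 1 ≤ S p) {T : ℕ → ℕ}
    (hT : ∀ p < n, T p = S (p + 1) - 1) (e y a : ℕ) (ha : a ≤ n) :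
    keyRank S v n (y * 2 ^ v + a) = keyRank S v n (y * 2 ^ v + a / e * e)
      + ((Finset.range (a % e)).filter fun j => T (a / e * e + j) = y).card := by
  have hdm : a / e * e + a % e = a := Nat.div_add_mod' a e
  rw [keyRank_add hn hS y (show a / e * e ≤ a by omega) ha]
  congr 1
  symm
  refine Finset.card_bij (fun j _ => a / e * e + j + 1) ?_ ?_ ?_
  · intro j hj
    simp only [Finset.mem_filter, Finset.mem_range, Finset.mem_Ioc] at hj ⊢
    rw [hT _ (by omega)] at hj
    have := hS (a / e * e + j + 1) (Finset.mem_Icc.2 (by omega))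
    omega
  · intro j _ j' _ h
    omega
  · intro p hp
    simp only [Finset.mem_filter, Finset.mem_range, Finset.mem_Ioc] at hp ⊢
    refine ⟨p - 1 - a / e * e, ⟨by omega, ?_⟩, by omega⟩
    rw [hT _ (by omega)]
    have : a / e * e + (p - 1 - a / e * e) + 1 = p := by omega
    rw [this]
    omega

/-- The total cost of ranking one position for different symbols. -/
theorem sum_cost_le (hn : n < 2 ^ v) (u me k q a : ℕ) (hk : k * 2 ^ me = 2 ^ u) (hk0 : 0 < k)
    (Ys : Finset ℕ) :
    q * ∑ y ∈ Ys, ((keyRank S v n (y * 2 ^ v + a)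
        - keyRank S v n ((y * 2 ^ v + a) / 2 ^ me * 2 ^ me)) / q
      + (keyRank S v n (((y * 2 ^ v + a) / 2 ^ u + 1) * 2 ^ u)
        - keyRank S v n ((y * 2 ^ v + a) / 2 ^ u * 2 ^ u)) / (q * k)) ≤ 3 * 2 ^ me := by
  have h1 := sum_keyRank_sub_le (S := S) hn a 0 (2 ^ me) Ys
    (fun y => (y * 2 ^ v + a) / 2 ^ me * 2 ^ me) (fun y => y * 2 ^ v + a) (fun y => le_rfl)
    (fun y => by
      have h1 := Nat.div_add_mod' (y * 2 ^ v + a) (2 ^ me)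
      have h2 := Nat.mod_lt (y * 2 ^ v + a) (Nat.two_pow_pos me)
      omega)
  -- The group around a query point reaches at most `2 ^ u = k * 2 ^ me` to either side; the later
  -- division by `q * k` removes the factor `k`.
  have h2 := sum_keyRank_sub_le (S := S) hn a (2 ^ u) (2 ^ u) Ys
    (fun y => (y * 2 ^ v + a) / 2 ^ u * 2 ^ u) (fun y => ((y * 2 ^ v + a) / 2 ^ u + 1) * 2 ^ u)
    (fun y => by
      have := Nat.div_mul_le_self (y * 2 ^ v + a) (2 ^ u)
      rw [add_one_mul]
      omega)
    (fun y => by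
      have h1 := Nat.div_add_mod' (y * 2 ^ v + a) (2 ^ u)
      have h2 := Nat.mod_lt (y * 2 ^ v + a) (Nat.two_pow_pos u)
      omega)
  rw [Finset.sum_add_distrib, mul_add]
  have h3 : q * ∑ y ∈ Ys, (keyRank S v n (y * 2 ^ v + a)
      - keyRank S v n ((y * 2 ^ v + a) / 2 ^ me * 2 ^ me)) / q ≤ 2 ^ me := by
    rw [Finset.mul_sum]
    refine (Finset.sum_le_sum fun y _ => Nat.mul_div_le _ _).trans ?_
    simpa using h1
  have h4 : q * ∑ y ∈ Ys, (keyRank S v n (((y * 2 ^ v + a) / 2 ^ u + 1) * 2 ^ u)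
      - keyRank S v n ((y * 2 ^ v + a) / 2 ^ u * 2 ^ u)) / (q * k) ≤ 2 * 2 ^ me := by
    refine Nat.le_of_mul_le_mul_left (c := k) ?_ hk0
    rw [Finset.mul_sum, Finset.mul_sum]
    calc _ ≤ ∑ y ∈ Ys, (keyRank S v n (((y * 2 ^ v + a) / 2 ^ u + 1) * 2 ^ u)
          - keyRank S v n ((y * 2 ^ v + a) / 2 ^ u * 2 ^ u)) :=
          Finset.sum_le_sum fun y _ => by
            rw [← mul_assoc, mul_comm k q]
            exact Nat.mul_div_le _ _
      _ ≤ 2 ^ u + 2 ^ u := h2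
      _ = _ := by rw [← hk]; ring
  omega

end KeyRank

/-! ### Choice of the parameters -/

/-- `L` and `l` are the rounded logarithms of `n` and `σ`, and `a` that of their quotient. -/
structure Sizes (w n σ L l a : ℕ) : Prop where
  n_lo : 2 ^ L ≤ n
  n_hi : n < 2 ^ (L + 1)
  σ_lo : 2 ^ l ≤ σ
  σ_hi : σ < 2 ^ (l + 1)
  L_pos : 1 ≤ L
  l_pos : 1 ≤ l
  L_lt : L < w
  l_lt : l < w
  n_lt : n < 2 ^ w
  σ_lt : σ < 2 ^ w
  a_lo : l * 2 ^ a ≤ max l L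
  a_hi : L < l * 2 ^ (a + 1)

namespace Sizes

variable {w n σ L l a : ℕ}

theorem of_log (hn : 2 ≤ n) (hσ : 2 ≤ σ) (hnw : n < 2 ^ w) (hσw : σ < 2 ^ w) :
    Sizes w n σ (Nat.log 2 n) (Nat.log 2 σ) (Nat.log 2 (Nat.log 2 n / Nat.log 2 σ)) := by
  have hL : 1 ≤ Nat.log 2 n := Nat.log_pos one_lt_two hn
  have hl : 1 ≤ Nat.log 2 σ := Nat.log_pos one_lt_two hσ
  refine ⟨Nat.pow_log_le_self 2 (by omega), Nat.lt_pow_succ_log_self one_lt_two n,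
    Nat.pow_log_le_self 2 (by omega), Nat.lt_pow_succ_log_self one_lt_two σ, hL, hl,
    Nat.log_lt_of_lt_pow (by omega) hnw, Nat.log_lt_of_lt_pow (by omega) hσw, hnw, hσw, ?_, ?_⟩
  · by_cases h : Nat.log 2 n / Nat.log 2 σ = 0
    · simp [h]
    · refine le_max_of_le_right ((Nat.mul_le_mul_left _ (Nat.pow_log_le_self 2 h)).trans ?_)
      exact Nat.mul_div_le _ _
  · have h1 := Nat.lt_pow_succ_log_self one_lt_two (Nat.log 2 n / Nat.log 2 σ)
    have h2 := Nat.lt_mul_div_succ (Nat.log 2 n) (show 0 < Nat.log 2 σ by omega)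
    exact h2.trans_le (Nat.mul_le_mul_left _ h1)


theorem L_lt_n (h : Sizes w n σ L l a) : L + 1 ≤ n := (Nat.lt_two_pow_self (n := L)).trans_le h.n_lo

theorem n_le (h : Sizes w n σ L l a) : n ≤ n * l := Nat.le_mul_of_pos_right _ h.l_pos

theorem l_le (h : Sizes w n σ L l a) : l ≤ n * l := Nat.le_mul_of_pos_left _ (by have := h.L_lt_n; omega)

theorem mul_le_of_pos (h : Sizes w n σ L l a) (ha : 1 ≤ a) : l * 2 ^ a ≤ L := by
  have h1 : 2 ^ 1 ≤ 2 ^ a := Nat.pow_le_pow_right (by norm_num) ha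
  have h2 : l * 2 ^ 1 ≤ l * 2 ^ a := Nat.mul_le_mul_left _ h1
  have := h.a_lo
  have := h.l_pos
  omega

theorem a_le (h : Sizes w n σ L l a) : a ≤ L := by
  rcases Nat.eq_zero_or_pos a with rfl | ha
  · omega
  · have h1 := h.mul_le_of_pos ha
    have h2 : 2 ^ a ≤ l * 2 ^ a := Nat.le_mul_of_pos_left _ h.l_pos
    have h3 := Nat.lt_two_pow_self (n := a)
    omega

end Sizes

/-- The width of the remainders of keys in their groups. -/
def remWidth (w l a : ℕ) : ℕ := min w (l + a + 2)

/-- The number of groups of keys. -/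
def groupCount (w σ L l a : ℕ) : ℕ := (σ * 2 ^ (L + 1) - 1) / 2 ^ remWidth w l a + 1

theorem div_lt_groupCount {w σ L l a x : ℕ} (hx : x < σ * 2 ^ (L + 1)) :
    x / 2 ^ remWidth w l a < groupCount w σ L l a :=
  Nat.lt_succ_of_le (Nat.div_le_div_right (by omega))

theorem mul_two_pow_add_lt {σ L y b : ℕ} (hy : y < σ) (hb : b < 2 ^ (L + 1)) :
    y * 2 ^ (L + 1) + b < σ * 2 ^ (L + 1) := by
  have := Nat.mul_le_mul_right (2 ^ (L + 1)) hy
  rw [Nat.succ_mul] at this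
  omega

namespace Sizes

variable {w n σ L l a : ℕ}

theorem remWidth_pos (h : Sizes w n σ L l a) : 0 < remWidth w l a := by
  have := h.L_lt
  unfold remWidth
  omega

theorem σ_mul_pos (h : Sizes w n σ L l a) : 0 < σ * 2 ^ (L + 1) :=
  Nat.mul_pos ((Nat.two_pow_pos l).trans_le h.σ_lo) (by positivity)

theorem groupCount_le (h : Sizes w n σ L l a) (hu : l + a + 2 ≤ w) :
    groupCount w σ L l a ≤ 2 ^ (L - a) := by
  have ha := h.a_le
  have e : 2 ^ (L - a) * 2 ^ (l + a + 2) = 2 ^ (l + 1) * 2 ^ (L + 1) := by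
    rw [← pow_add, ← pow_add]
    congr 1
    omega
  rw [groupCount, remWidth, min_eq_right hu, Nat.succ_le_iff,
    Nat.div_lt_iff_lt_mul (by positivity), e]
  have h1 := Nat.mul_lt_mul_of_pos_right h.σ_hi (Nat.two_pow_pos (L + 1))
  have h2 := h.σ_mul_pos
  omega

theorem groupCount_lt (h : Sizes w n σ L l a) : groupCount w σ L l a < 2 ^ w := by
  rcases le_total (l + a + 2) w with hu | hu
  · exact (h.groupCount_le hu).trans_lt (Nat.pow_lt_pow_right (by norm_num)
      (by have := h.L_lt; omega))
  · refine lt_of_le_of_lt ?_ h.σ_lt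
    rw [groupCount, remWidth, min_eq_left hu, Nat.succ_le_iff,
      Nat.div_lt_iff_lt_mul (by positivity)]
    have h1 : σ * 2 ^ (L + 1) ≤ σ * 2 ^ w :=
      Nat.mul_le_mul_left _ (Nat.pow_le_pow_right (by norm_num) h.L_lt)
    have h2 := h.σ_mul_pos
    omega

/-- This pays for `L + 1` bits per group. If the remainder width is capped by the word size, there
may be `2 ^ (L + 1)` groups, but then `L < w < l + a + 2 ≤ 3 * l + 10`, so that `L = O(l)`. -/
theorem groupCount_mul_le (h : Sizes w n σ L l a) (ha : l + a + 2 ≤ w ∨ a ≤ 2 * l + 8) :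
    groupCount w σ L l a * (L + 1) ≤ 24 * (n * l) := by
  have hl := h.l_pos
  have hL := h.L_pos
  rcases le_or_gt (l + a + 2) w with hu | hu
  · have h1 := h.groupCount_le hu
    have h2 := h.a_hi
    calc groupCount w σ L l a * (L + 1) ≤ 2 ^ (L - a) * (l * 2 ^ (a + 1)) :=
          Nat.mul_le_mul h1 h2
      _ = 2 * (2 ^ (L - a + a) * l) := by rw [pow_succ, pow_add]; ring
      _ = 2 * (2 ^ L * l) := by rw [Nat.sub_add_cancel h.a_le]
      _ ≤ 2 * (n * l) := Nat.mul_le_mul_left _ (Nat.mul_le_mul_right _ h.n_lo)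
      _ ≤ _ := by omega
  · have h1 : groupCount w σ L l a ≤ 2 ^ (L + 1) := by
      rw [groupCount, remWidth, min_eq_left hu.le, Nat.succ_le_iff,
        Nat.div_lt_iff_lt_mul (by positivity)]
      have h1 := Nat.mul_lt_mul_of_pos_right h.σ_lt (Nat.two_pow_pos (L + 1))
      have h2 := h.σ_mul_pos
      rw [mul_comm (2 ^ (L + 1))]
      omega
    have h2 : L + 1 ≤ 12 * l := by have := h.L_lt; omega
    calc groupCount w σ L l a * (L + 1) ≤ 2 ^ (L + 1) * (12 * l) := Nat.mul_le_mul h1 h2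
      _ = 24 * (2 ^ L * l) := by rw [pow_succ]; ring
      _ ≤ _ := Nat.mul_le_mul_left _ (Nat.mul_le_mul_right _ h.n_lo)

/-- A table with few index bits is small. -/
theorem table_mul_le (h : Sizes w n σ L l a) {e : ℕ} (he : e + L / 8 ≤ L) :
    2 ^ e * (L + 1) ≤ 8 * (n * l) := by
  -- The `L / 8` spare bits in the exponent pay for the entry width `L + 1`.
  have h1 : L / 8 < 2 ^ (L / 8) := Nat.lt_two_pow_self
  calc 2 ^ e * (L + 1) ≤ 2 ^ e * (8 * 2 ^ (L / 8)) := Nat.mul_le_mul_left _ (by omega)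
    _ = 8 * 2 ^ (e + L / 8) := by rw [pow_add]; ring
    _ ≤ 8 * 2 ^ L := Nat.mul_le_mul_left _ (Nat.pow_le_pow_right (by norm_num) he)
    _ ≤ _ := Nat.mul_le_mul_left _ (h.n_lo.trans h.n_le)

end Sizes

/-- The logarithm of the number of blocks in a group. -/
def blockLog (L : ℕ) : ℕ := Nat.log 2 (L / 8)

/-- For `L < 8` the logarithm is taken of zero; its default value gives a single block. -/
theorem two_pow_blockLog_le (L : ℕ) : L < 8 ∧ blockLog L = 0 ∨ 2 ^ blockLog L ≤ L / 8 := by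
  by_cases hL : L / 8 = 0
  · exact Or.inl ⟨by omega, by simp [blockLog, hL]⟩
  · exact Or.inr (Nat.pow_log_le_self 2 hL)

theorem lt_two_pow_blockLog {L : ℕ} : L < 24 * 2 ^ blockLog L := by
  have h := Nat.lt_pow_succ_log_self one_lt_two (L / 8)
  have h1 : 0 < 2 ^ blockLog L := Nat.two_pow_pos _
  rw [pow_succ] at h
  change L / 8 < 2 ^ blockLog L * 2 at h
  omega

namespace Sizes

variable {w n σ L l a : ℕ}

theorem two_mul_blocks_le (h : Sizes w n σ L l a) : 2 * 2 ^ blockLog L ≤ L + 1 := by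
  have := h.L_pos
  rcases two_pow_blockLog_le L with ⟨h1, h2⟩ | h1
  · rw [h2]; omega
  · omega

theorem blocks_lt (h : Sizes w n σ L l a) : 2 ^ blockLog L < 2 ^ (L + 1) := by
  have := h.two_mul_blocks_le
  have := Nat.lt_two_pow_self (n := L + 1)
  omega

theorem unary_table_lt (h : Sizes w n σ L l a) : 2 ^ (2 * 2 ^ blockLog L) * 2 ^ blockLog L ≤ 2 ^ w := by
  have hL := h.L_lt
  have hL' := h.L_pos
  rw [← pow_add]
  refine Nat.pow_le_pow_right (by norm_num) ?_
  rcases two_pow_blockLog_le L with ⟨h1, h2⟩ | h1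
  · rw [h2]; omega
  · have := Nat.lt_two_pow_self (n := blockLog L)
    omega

theorem unary_table_mul_le (h : Sizes w n σ L l a) :
    2 ^ (2 * 2 ^ blockLog L) * 2 ^ blockLog L * (L + 1) ≤ 32 * (n * l) := by
  rcases two_pow_blockLog_le L with ⟨h1, h2⟩ | h1
  · have h3 := h.L_lt_n.trans h.n_le
    rw [h2]
    omega
  · rw [← pow_add]
    have := Nat.lt_two_pow_self (n := blockLog L)
    have h3 := h.table_mul_le (e := 2 * 2 ^ blockLog L + blockLog L) (by omega)
    omega

/-- A group spans at least as many key values as it has blocks, so the subtraction in the block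
width is not truncated. -/
theorem blockLog_le (h : Sizes w n σ L l a) : blockLog L ≤ remWidth w l a := by
  have h1 := h.two_mul_blocks_le
  have h2 := h.L_lt
  have h3 := Nat.lt_two_pow_self (n := blockLog L)
  refine le_min (by omega) ?_
  have h4 : 2 ^ blockLog L ≤ 2 ^ (l + a + 2) := by
    have h5 := h.a_hi
    have h6 : l * 2 ^ (a + 1) ≤ 2 ^ l * 2 ^ (a + 1) :=
      Nat.mul_le_mul_right _ Nat.lt_two_pow_self.le
    rw [← pow_add] at h6
    have h7 : 2 ^ (l + (a + 1)) ≤ 2 ^ (l + a + 2) := Nat.pow_le_pow_right (by norm_num) (by omega)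
    omega
  exact (Nat.pow_le_pow_iff_right (by norm_num)).1 h4

theorem chunk_mul_le (h : Sizes w n σ L l a) : 2 ^ (a - 6) ≤ L + 1 := by
  have h1 : 2 ^ (a - 6) ≤ 2 ^ a := Nat.pow_le_pow_right (by norm_num) (by omega)
  rcases Nat.eq_zero_or_pos a with rfl | ha
  · simp
  · have h2 := h.mul_le_of_pos ha
    have h3 : 2 ^ a ≤ l * 2 ^ a := Nat.le_mul_of_pos_left _ h.l_pos
    omega

theorem remWidth_le (h : Sizes w n σ L l a) (ha : a ≤ 2 * l + 8) : remWidth w l a ≤ 13 * l :=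
  (min_le_right _ _).trans (by have := h.l_pos; omega)

/-- Chunks of several fields are short. -/
theorem chunk_width_le (h : Sizes w n σ L l a) (ha : a ≤ 2 * l + 8) (ha' : 6 < a) :
    64 * (2 ^ (a - 6) * remWidth w l a + remWidth w l a) ≤ 26 * L := by
  have h1 := h.mul_le_of_pos (by omega)
  have h2 : remWidth w l a ≤ 2 ^ (a - 6) * remWidth w l a :=
    Nat.le_mul_of_pos_left _ (by positivity)
  have h3 : 2 ^ (a - 6) * remWidth w l a ≤ 2 ^ (a - 6) * (13 * l) :=
    Nat.mul_le_mul_left _ (h.remWidth_le ha)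
  have h4 : 2 ^ a = 2 ^ (a - 6) * 64 := by
    conv_lhs => rw [← Nat.sub_add_cancel ha'.le, pow_add]
    norm_num
  have h5 : 2 ^ (a - 6) * (13 * l) * 64 = 13 * (l * 2 ^ a) := by rw [h4]; ring
  omega

/-- A block spans `2 ^ u / k` values, and the constant is `24 * 4 * 64`: `L < 24 * k`, `2 ^ u ≤ 4 *
2 ^ l * 2 ^ a`, and `2 ^ a ≤ 64 * q`. -/
theorem block_mul_le (h : Sizes w n σ L l a) :
    2 ^ (remWidth w l a - blockLog L) * L ≤ 6144 * (σ * 2 ^ (a - 6)) := by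
  have h1 := lt_two_pow_blockLog (L := L)
  have h2 : 2 ^ (remWidth w l a - blockLog L) * 2 ^ blockLog L = 2 ^ remWidth w l a := by
    rw [← pow_add, Nat.sub_add_cancel h.blockLog_le]
  have h3 : 2 ^ remWidth w l a ≤ 2 ^ (l + a + 2) :=
    Nat.pow_le_pow_right (by norm_num) (min_le_right _ _)
  have h4 : 2 ^ a ≤ 2 ^ (a - 6) * 64 := by
    rw [show 64 = 2 ^ 6 by norm_num, ← pow_add]
    exact Nat.pow_le_pow_right (by norm_num) (by omega)
  calc 2 ^ (remWidth w l a - blockLog L) * L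
      ≤ 2 ^ (remWidth w l a - blockLog L) * (24 * 2 ^ blockLog L) :=
        Nat.mul_le_mul_left _ h1.le
    _ = 24 * 2 ^ remWidth w l a := by rw [← h2]; ring
    _ ≤ 24 * 2 ^ (l + a + 2) := Nat.mul_le_mul_left _ h3
    _ = 96 * (2 ^ l * 2 ^ a) := by rw [pow_add, pow_add]; ring
    _ ≤ 96 * (σ * (2 ^ (a - 6) * 64)) := Nat.mul_le_mul_left _ (Nat.mul_le_mul h.σ_lo h4)
    _ = _ := by ring

end Sizes

/-! ### The index: layout, space and total query cost -/

namespace WordRAM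

/-- The parameters in arrays `0` to `13`, and further arrays. -/
def layout (par : ℕ → ℕ) (arr : ℕ → List Bool) (x : Fin 23) : List Bool :=
  if x.val < 14 then numBits (par x) else arr x

/-- The data arrays `D` with the parameters `par` support the computation of frequencies. -/
structure IsIndex (w n σ : ℕ) (S : ℕ → ℕ) (D : Fin 23 → List Bool) (par : ℕ → ℕ)
    (ρ cost : ℕ → ℕ → ℕ) : Prop where
  par_eq : ∀ (x : Fin 23) (a : BitVec w), x.val < 14 → a.toNat = 0 →
    (packBits w (D x) a).toNat = par x
  ranks : Ranks (fun x => packBits w (D x)) par n σ ρ cost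
  freq : ∀ y < σ, ∀ i j, 1 ≤ i → i ≤ j → j ≤ n →
    ρ y (i - 1) + rangeFreq S i j (y + 1) = ρ y j
  cost_le : ∀ (Ys : Finset ℕ) (b : ℕ), b ≤ n →
    (∑ y ∈ Ys, cost y b) * Nat.log 2 n ≤ 302 * Ys.card * Nat.log 2 n + 700000 * σ

theorem layout_par {w : ℕ} {par : ℕ → ℕ} {arr : ℕ → List Bool} (hpar : ∀ x, par x ≤ w) (x : Fin 23)
    (a : BitVec w) (hx : x.val < 14) (ha : a.toNat = 0) :
    (packBits w (layout par arr x) a).toNat = par x := by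
  rw [layout, if_pos hx, packBits_numBits ((hpar x).trans_lt Nat.lt_two_pow_self) ha]

theorem length_layout_le {par : ℕ → ℕ} {arr : ℕ → List Bool} {b : ℕ} (hpar : ∀ x, par x ≤ b)
    (harr : ∀ x, (arr x).length ≤ b) (x : Fin 23) : (layout par arr x).length ≤ b := by
  unfold layout
  split_ifs
  · rw [numBits, length_bitList]; exact hpar x
  · exact harr x

/-- The parameters in the order in which they are stored. -/
def params (dense v u me k q tbl se sw : ℕ) : ℕ → ℕ
  | 0 => 1
  | 1 => dense
  | 2 => v
  | 3 => u
  | 4 => u - v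
  | 5 => v - u
  | 6 => min u v
  | 7 => me
  | 8 => k
  | 9 => q
  | 10 => tbl
  | 11 => se
  | 12 => sw
  | 13 => v - se
  | _ => 0

theorem params_le {dense v u me k q tbl se sw b : ℕ} (h0 : 1 ≤ b) (h1 : dense ≤ 1) (hv : v ≤ b)
    (hu : u ≤ b) (hme : me ≤ b) (hk : k ≤ b) (hq : q ≤ b) (ht : tbl ≤ 1) (hse : se ≤ b)
    (hsw : sw ≤ b) (x : ℕ) : params dense v u me k q tbl se sw x ≤ b := by
  unfold params
  split <;> omega

theorem hasParams_of_eq {w dense v u me k q tbl se sw : ℕ} {E : ℕ → ℕ} (h3 : E 3 = w)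
    (h : ∀ i < 14, E (4 + i) = params dense v u me k q tbl se sw i) :
    HasParams w v u me k q tbl se sw E :=
  ⟨h3, h 2 (by norm_num), h 3 (by norm_num), h 4 (by norm_num), h 5 (by norm_num),
    h 6 (by norm_num), h 7 (by norm_num), h 8 (by norm_num), h 9 (by norm_num),
    h 10 (by norm_num), h 11 (by norm_num), h 12 (by norm_num), h 13 (by norm_num)⟩

/-- An alphabet with one symbol needs no data. -/
theorem isIndex_trivial {w n : ℕ} {S : ℕ → ℕ} (hS : ∀ p ∈ Finset.Icc 1 n, S p = 1) :
    IsIndex w n 1 S (fun _ => []) (fun _ => 0) (fun _ a => a) (fun _ _ => 3) := by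
  refine ⟨fun x a _ _ => by simp [packBits], ?_, ?_, ?_⟩
  · intro s E m a y hM h3 hpar ha hy _ _
    -- An empty array reads as zero, so the first parameter selects the branch that returns the
    -- position itself as the rank.
    refine Runs.iteFalse (by rw [hM.val 4 (by norm_num)]; exact hpar 0 (by norm_num)) ?_
    refine hM.copy a ha fun s1 h1 => h1.skip fun s2 h2 => ⟨⟨_, h2, fun i hi => ?_, by simp⟩, le_rfl⟩
    rw [update_low hi le_rfl]
  · intro y hy i j hi hij hj
    have : (Finset.Icc i j).filter (fun p => S p = 0 + 1) = Finset.Icc i j :=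
      Finset.filter_true_of_mem fun p hp => by
        rw [Finset.mem_Icc] at hp
        exact hS p (Finset.mem_Icc.2 (by omega))
    rw [Nat.lt_one_iff.1 hy, rangeFreq, this, Nat.card_Icc]
    omega
  · intro Ys b _
    rw [Finset.sum_const, smul_eq_mul, mul_comm _ 3]
    exact (Nat.mul_le_mul_right _ (Nat.mul_le_mul_right _ (by norm_num))).trans
      (Nat.le_add_right _ _)

/-! ### Larger alphabets: sorted chunks -/

section Sparse

variable (w n σ : ℕ) (S : ℕ → ℕ) (L l a : ℕ)

/-- The parameters for a sparse alphabet. -/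
def sparseParams : ℕ → ℕ :=
  params 0 (L + 1) (remWidth w l a) (remWidth w l a - blockLog L) (2 ^ blockLog L) (2 ^ (a - 6))
    (if 6 < a then 1 else 0) 0 0

/-- The data arrays for a sparse alphabet. -/
noncomputable def sparseArrays (x : ℕ) : List Bool :=
  if x = 14 then fieldList w (L + 1) (groupCount w σ L l a) fun g =>
    keyRank S (L + 1) n (g * 2 ^ remWidth w l a)
  else if x = 15 then fieldList w (L + 1) (groupCount w σ L l a + 1)
    (chunkStart (remWidth w l a) (2 ^ (a - 6)) (keyRank S (L + 1) n))
  else if x = 16 then fieldList w (2 * 2 ^ blockLog L) (groupCount w σ L l a) fun g =>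
    unary (2 ^ blockLog L) (skipCount (remWidth w l a) (remWidth w l a - blockLog L)
      (2 ^ blockLog L) (2 ^ (a - 6)) (keyRank S (L + 1) n) g)
  else if x = 17 then fieldList w (L + 1) (2 ^ (2 * 2 ^ blockLog L) * 2 ^ blockLog L) fun i =>
    unaryDecode (i / 2 ^ blockLog L) (i % 2 ^ blockLog L)
  else if x = 18 then fieldList w (2 ^ (a - 6) * remWidth w l a)
    (chunkStart (remWidth w l a) (2 ^ (a - 6)) (keyRank S (L + 1) n) (groupCount w σ L l a))
    (chunkNum (remWidth w l a) (2 ^ (a - 6)) (keyRank S (L + 1) n) (groupCount w σ L l a))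
  else if x = 19 ∧ 6 < a then
    fieldList w (L + 1) (2 ^ (2 ^ (a - 6) * remWidth w l a + remWidth w l a)) fun i =>
      fieldsBelow (remWidth w l a) (2 ^ (a - 6)) (i / 2 ^ remWidth w l a) (i % 2 ^ remWidth w l a)
  else []

variable {w n σ S L l a}

theorem chunk_width_le_word (h : Sizes w n σ L l a) (ha : a ≤ 2 * l + 8) :
    2 ^ (a - 6) * remWidth w l a ≤ w := by
  by_cases h6 : 6 < a
  · have := h.chunk_width_le ha h6
    have := h.L_lt
    omega
  · rw [Nat.sub_eq_zero_of_le (by omega), pow_zero, one_mul]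
    exact min_le_left _ _

theorem sparseData (h : Sizes w n σ L l a) (ha : a ≤ 2 * l + 8) :
    SparseData w (L + 1) (remWidth w l a) (remWidth w l a - blockLog L) (2 ^ blockLog L)
      (2 ^ (a - 6)) (if 6 < a then 1 else 0) (groupCount w σ L l a) (keyRank S (L + 1) n)
      fun x => packBits w (layout (sparseParams w L l a) (sparseArrays w n σ S L l a) x) where
  mono := keyRank_mono
  bound x := (keyRank_le x).trans_lt h.n_hi
  v_pos := Nat.succ_pos _
  v_le := h.L_lt
  u_pos := h.remWidth_pos
  u_le := min_le_left _ _
  k_pos := Nat.two_pow_pos _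
  k_mul := by rw [← pow_add, Nat.add_sub_cancel' h.blockLog_le]
  k_le := h.two_mul_blocks_le.trans h.L_lt
  k_lt := h.blocks_lt.le
  unary_le := h.unary_table_lt
  q_pos := Nat.two_pow_pos _
  q_lt := h.chunk_mul_le.trans_lt Nat.lt_two_pow_self
  chunk_le := chunk_width_le_word h ha
  table_le ht := by
    have h6 : 6 < a := (Ne.ite_ne_right_iff one_ne_zero).1 ht
    have := h.chunk_width_le ha h6
    have := h.L_lt
    omega
  q_eq ht := by
    have h6 : ¬ 6 < a := fun h6 => by rw [if_pos h6] at ht; exact one_ne_zero ht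
    rw [Nat.sub_eq_zero_of_le (by omega), pow_zero]
  groups_lt := h.groupCount_lt
  base := rfl
  start := rfl
  skips := rfl
  decode := rfl
  chunks := rfl
  table ht := by
    have h6 : 6 < a := (Ne.ite_ne_right_iff one_ne_zero).1 ht
    simp [layout, sparseArrays, h6]

theorem length_sparseArrays_le (h : Sizes w n σ L l a) (ha : a ≤ 2 * l + 8) (x : ℕ) :
    (sparseArrays w n σ S L l a x).length ≤ 1000 * (n * l) := by
  have hv : 0 < L + 1 := Nat.succ_pos _
  have hG := h.groupCount_mul_le (Or.inr ha)
  have hLn := h.L_lt_n.trans h.n_le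
  have hk := h.two_mul_blocks_le
  unfold sparseArrays
  split_ifs with _ _ _ _ _ h6
  · refine (length_fieldList_le _ _ hv h.L_lt).trans ?_
    omega
  · refine (length_fieldList_le _ _ hv h.L_lt).trans ?_
    rw [add_one_mul]
    omega
  · refine (length_fieldList_le _ _ (by positivity) (hk.trans h.L_lt)).trans ?_
    have := Nat.mul_le_mul_left (groupCount w σ L l a) hk
    omega
  · refine (length_fieldList_le _ _ hv h.L_lt).trans ?_
    have := h.unary_table_mul_le
    omega
  · refine (length_fieldList_le _ _ (Nat.mul_pos (by positivity) h.remWidth_pos)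
      (chunk_width_le_word h ha)).trans ?_
    have h1 := chunkStart_mul_le (u := remWidth w l a) (q := 2 ^ (a - 6))
      (keyRank_mono (S := S) (v := L + 1) (n := n)) (groupCount w σ L l a)
    have h2 := keyRank_le (S := S) (v := L + 1) (n := n)
      (groupCount w σ L l a * 2 ^ remWidth w l a)
    -- The padding of a group amounts to `O(L)` bits and is charged to the group like its base rank.
    have h3 : (2 ^ (a - 6) - 1) * remWidth w l a ≤ L + 1 := by
      by_cases h6 : 6 < a
      · have := h.chunk_width_le ha h6
        rw [tsub_mul]
        omega
      · rw [Nat.sub_eq_zero_of_le (show a ≤ 6 by omega)]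
        simp
    have h4 := Nat.mul_le_mul_left (groupCount w σ L l a) h3
    have h5 := Nat.mul_le_mul_left n (h.remWidth_le ha)
    have h6 := Nat.mul_le_mul_right (remWidth w l a) (h1.trans (Nat.add_le_add_right h2 _))
    rw [add_mul, mul_assoc, mul_assoc] at h6
    have h7 : n * (13 * l) = 13 * (n * l) := by ring
    omega
  · refine (length_fieldList_le _ _ hv h.L_lt).trans ?_
    have h1 := h.chunk_width_le ha h6.2
    have h2 := h.table_mul_le (e := 2 ^ (a - 6) * remWidth w l a + remWidth w l a) (by omega)
    omega
  · simp

theorem isIndex_sparse (h : Sizes w n σ L l a) (hL : L = Nat.log 2 n) (ha : a ≤ 2 * l + 8)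
    (hS : ∀ p ∈ Finset.Icc 1 n, S p ∈ Finset.Icc 1 σ) :
    IsIndex w n σ S (layout (sparseParams w L l a) (sparseArrays w n σ S L l a))
      (sparseParams w L l a) (fun y b => keyRank S (L + 1) n (y * 2 ^ (L + 1) + b))
      (fun y b => 302 + 36 * ((keyRank S (L + 1) n (y * 2 ^ (L + 1) + b)
        - keyRank S (L + 1) n ((y * 2 ^ (L + 1) + b) / 2 ^ (remWidth w l a - blockLog L)
          * 2 ^ (remWidth w l a - blockLog L))) / 2 ^ (a - 6)
        + (keyRank S (L + 1) n (((y * 2 ^ (L + 1) + b) / 2 ^ remWidth w l a + 1)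
            * 2 ^ remWidth w l a)
          - keyRank S (L + 1) n ((y * 2 ^ (L + 1) + b) / 2 ^ remWidth w l a
            * 2 ^ remWidth w l a)) / (2 ^ (a - 6) * 2 ^ blockLog L))) := by
  have hD := sparseData (S := S) h ha
  refine ⟨layout_par (params_le ?_ ?_ ?_ ?_ ?_ ?_ ?_ ?_ ?_ ?_), ?_, ?_, ?_⟩
  · have := h.L_lt; omega
  · omega
  · exact h.L_lt
  · exact hD.u_le
  · exact (Nat.sub_le _ _).trans hD.u_le
  · have := hD.k_le; omega
  · exact h.chunk_mul_le.trans h.L_lt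
  · split_ifs <;> omega
  · exact Nat.zero_le _
  · exact Nat.zero_le _
  · intro s E m b y hM h3 hpar hb hy hbn hyσ
    have hbv : b < 2 ^ (L + 1) := hbn.trans_lt h.n_hi
    refine Runs.iteTrue ?_ (Runs.iteFalse ?_ ?_)
    · rw [hM.val 4 (by norm_num), hpar 0 (by norm_num)]
      exact one_ne_zero
    · rw [hM.val 5 (by norm_num)]
      exact hpar 1 (by norm_num)
    · refine (sparseRank_runs hD (hasParams_of_eq h3 hpar) hM hb hy hbv rfl
        (div_lt_groupCount (mul_two_pow_add_lt hyσ hbv))).mono fun s' t ht => ⟨ht.1, ?_⟩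
      have := ht.2
      dsimp only
      omega
  · intro y _ i j hi hij hj
    exact keyRank_add_rangeFreq h.n_hi (fun p hp => (Finset.mem_Icc.1 (hS p hp)).1) y hi hij hj
  · intro Ys b _
    have h1 := sum_cost_le (S := S) h.n_hi (remWidth w l a) (remWidth w l a - blockLog L)
      (2 ^ blockLog L) (2 ^ (a - 6)) b hD.k_mul hD.k_pos Ys
    have h2 := h.block_mul_le
    rw [← hL, Finset.sum_add_distrib, ← Finset.mul_sum, Finset.sum_const, smul_eq_mul]
    generalize @Finset.sum ℕ ℕ _ Ys _ = X at h1 ⊢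
    -- Here `18432 = 3 * 6144`, and `36 * 18432` stays below `700000`.
    have h3 : X * L ≤ 18432 * σ := by
      refine Nat.le_of_mul_le_mul_left (c := 2 ^ (a - 6)) ?_ (by positivity)
      calc 2 ^ (a - 6) * (X * L) = 2 ^ (a - 6) * X * L := by ring
        _ ≤ 3 * 2 ^ (remWidth w l a - blockLog L) * L := Nat.mul_le_mul_right _ h1
        _ = 3 * (2 ^ (remWidth w l a - blockLog L) * L) := by ring
        _ ≤ 3 * (6144 * (σ * 2 ^ (a - 6))) := Nat.mul_le_mul_left _ h2
        _ = _ := by ring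
    calc (Ys.card * 302 + 36 * X) * L = 302 * Ys.card * L + 36 * (X * L) := by ring
      _ ≤ _ := by omega

theorem length_sparse_le (h : Sizes w n σ L l a) (ha : a ≤ 2 * l + 8) (x : Fin 23) :
    (layout (sparseParams w L l a) (sparseArrays w n σ S L l a) x).length ≤ 1000 * (n * l) := by
  have hLn := h.L_lt_n.trans h.n_le
  have hl := h.l_le
  have hu := h.remWidth_le ha
  refine length_layout_le (params_le ?_ ?_ ?_ ?_ ?_ ?_ ?_ ?_ ?_ ?_) (length_sparseArrays_le h ha) x
  · omega
  · omega
  · omega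
  · omega
  · omega
  · have := h.two_mul_blocks_le; omega
  · have := h.chunk_mul_le; omega
  · split_ifs <;> omega
  · exact Nat.zero_le _
  · exact Nat.zero_le _

end Sparse

/-! ### Small alphabets: explicit block ranks and text blocks -/

section Dense

variable (w n σ : ℕ) (S : ℕ → ℕ) (L l a : ℕ)

/-- The parameters for a small alphabet. -/
def denseParams : ℕ → ℕ := params 1 (L + 1) (remWidth w l a) 0 0 0 0 (a - 5) (l + 1)

/-- The data arrays for a small alphabet. -/
def denseArrays (x : ℕ) : List Bool :=
  if x = 14 then fieldList w (L + 1) (groupCount w σ L l a) fun g =>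
    keyRank S (L + 1) n (g * 2 ^ remWidth w l a)
  else if x = 20 then fieldList w (remWidth w l a) (σ * 2 ^ (L + 1 - (a - 5))) fun b =>
    keyRank S (L + 1) n (b * 2 ^ (a - 5))
      - keyRank S (L + 1) n (b * 2 ^ (a - 5) / 2 ^ remWidth w l a * 2 ^ remWidth w l a)
  else if x = 21 then fieldList w ((l + 1) * 2 ^ (a - 5)) (n / 2 ^ (a - 5) + 1) fun c =>
    packNat (l + 1) (2 ^ (a - 5)) fun j => (S (c * 2 ^ (a - 5) + j + 1) - 1) % 2 ^ (l + 1)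
  else if x = 22 then
    fieldList w (L + 1) (2 ^ ((l + 1) * 2 ^ (a - 5) + (l + 1) + (a - 5))) fun i =>
      fieldsEqual (l + 1) (i / 2 ^ (a - 5) / 2 ^ (l + 1)) (i / 2 ^ (a - 5) % 2 ^ (l + 1))
        (i % 2 ^ (a - 5))
  else []

variable {w n σ S L l a}

/-- From `l * 2 ^ a ≤ L`, shortening blocks by `2 ^ 5` and doubling `l` to cover `l + 1` leave a
sixteenth of `L`. This keeps the table of block contents polynomially smaller than `n`. -/
theorem text_block_width_le (h : Sizes w n σ L l a) (ha : 2 * l + 8 < a) :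
    16 * ((l + 1) * 2 ^ (a - 5)) ≤ L := by
  have h1 := h.mul_le_of_pos (by omega)
  have h2 : 2 ^ a = 2 ^ (a - 5) * 32 := by
    conv_lhs => rw [← Nat.sub_add_cancel (show 5 ≤ a by omega), pow_add]
    norm_num
  have h3 : (l + 1) * 2 ^ (a - 5) ≤ 2 * l * 2 ^ (a - 5) :=
    Nat.mul_le_mul_right _ (by have := h.l_pos; omega)
  have h4 : 2 * l * 2 ^ (a - 5) * 16 = l * 2 ^ a := by rw [h2]; ring
  omega

theorem text_table_width_le (h : Sizes w n σ L l a) (ha : 2 * l + 8 < a) :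
    16 * ((l + 1) * 2 ^ (a - 5) + (l + 1) + (a - 5)) ≤ 3 * L := by
  have h1 := text_block_width_le h ha
  have h2 : l + 1 ≤ (l + 1) * 2 ^ (a - 5) := Nat.le_mul_of_pos_right _ (by positivity)
  have h3 : 2 ^ (a - 5) ≤ (l + 1) * 2 ^ (a - 5) := Nat.le_mul_of_pos_left _ (by omega)
  have h4 := Nat.lt_two_pow_self (n := a - 5)
  omega

theorem remWidth_dense (h : Sizes w n σ L l a) (ha : 2 * l + 8 < a) :
    l + a + 2 ≤ w ∧ remWidth w l a = l + a + 2 := by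
  have h1 := text_table_width_le h ha
  have h2 := h.L_lt
  have h3 : l + a + 2 ≤ w := by omega
  exact ⟨h3, min_eq_right h3⟩

/-- The exponents add up to exactly `L`. The spare factor `2 ^ (a - l - 7)` is what pays for the `l
+ a + 2` bits stored per block and symbol. -/
theorem block_count_le (h : Sizes w n σ L l a) (ha : 2 * l + 8 < a) :
    σ * 2 ^ (L + 1 - (a - 5)) * 2 ^ (a - l - 7) ≤ 2 ^ L := by
  have h1 := h.a_le
  calc σ * 2 ^ (L + 1 - (a - 5)) * 2 ^ (a - l - 7)
      ≤ 2 ^ (l + 1) * 2 ^ (L + 1 - (a - 5)) * 2 ^ (a - l - 7) :=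
        Nat.mul_le_mul_right _ (Nat.mul_le_mul_right _ h.σ_hi.le)
    _ = 2 ^ (l + 1 + (L + 1 - (a - 5)) + (a - l - 7)) := by rw [← pow_add, ← pow_add]
    _ = 2 ^ L := by congr 1; omega

theorem denseData (h : Sizes w n σ L l a) (ha : 2 * l + 8 < a)
    (hS : ∀ p ∈ Finset.Icc 1 n, S p ∈ Finset.Icc 1 σ) :
    DenseData w (L + 1) (remWidth w l a) (a - 5) (l + 1) (groupCount w σ L l a)
      (σ * 2 ^ (L + 1 - (a - 5))) (n / 2 ^ (a - 5) + 1) n (keyRank S (L + 1) n)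
      (fun p => (S (p + 1) - 1) % 2 ^ (l + 1))
      fun x => packBits w (layout (denseParams w L l a) (denseArrays w n σ S L l a) x) where
  mono := keyRank_mono
  bound x := (keyRank_le x).trans_lt h.n_hi
  lip := keyRank_lip h.n_hi
  v_pos := Nat.succ_pos _
  v_le := h.L_lt
  u_pos := h.remWidth_pos
  u_le := min_le_left _ _
  se_le_v := by have := h.a_le; omega
  se_le_u := by rw [(remWidth_dense h ha).2]; omega
  sw_pos := Nat.succ_pos _
  table_le := by
    have := text_table_width_le h ha
    have := h.L_lt
    omega
  groups_lt := h.groupCount_lt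
  blocks_lt := by
    have h1 := block_count_le h ha
    have h2 := Nat.le_mul_of_pos_right (σ * 2 ^ (L + 1 - (a - 5))) (Nat.two_pow_pos (a - l - 7))
    have h3 : 2 ^ L ≤ 2 ^ w := Nat.pow_le_pow_right (by norm_num) h.L_lt.le
    omega
  -- The reduction changes no symbol of `S[1..n]`; it only bounds the fields that the last text
  -- block holds beyond the end.
  text p := Nat.mod_lt _ (by positivity)
  block y b hb := keyRank_block (T := fun p => (S (p + 1) - 1) % 2 ^ (l + 1)) h.n_hi
    (fun p hp => (Finset.mem_Icc.1 (hS p hp)).1)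
    (fun p hp => by
      have := Finset.mem_Icc.1 (hS (p + 1) (Finset.mem_Icc.2 (by omega)))
      have := h.σ_hi
      exact Nat.mod_eq_of_lt (by omega)) _ y b hb
  base := rfl
  blocks := rfl
  texts := rfl
  table := rfl

theorem length_denseArrays_le (h : Sizes w n σ L l a) (ha : 2 * l + 8 < a) (x : ℕ) :
    (denseArrays w n σ S L l a x).length ≤ 1000 * (n * l) := by
  have hv : 0 < L + 1 := Nat.succ_pos _
  obtain ⟨hw, hu⟩ := remWidth_dense h ha
  have hLn := h.L_lt_n.trans h.n_le
  have hT := text_block_width_le h ha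
  have hLw := h.L_lt
  unfold denseArrays
  split_ifs
  · refine (length_fieldList_le _ _ hv h.L_lt).trans ?_
    have := h.groupCount_mul_le (Or.inl hw)
    omega
  · refine (length_fieldList_le _ _ h.remWidth_pos (min_le_left _ _)).trans ?_
    have h1 := block_count_le h ha
    have h2 : remWidth w l a ≤ 384 * 2 ^ (a - l - 7) := by
      have := Nat.lt_two_pow_self (n := a - l - 7)
      omega
    have h3 := Nat.mul_le_mul_left (σ * 2 ^ (L + 1 - (a - 5))) h2
    have h4 : σ * 2 ^ (L + 1 - (a - 5)) * (384 * 2 ^ (a - l - 7))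
      = 384 * (σ * 2 ^ (L + 1 - (a - 5)) * 2 ^ (a - l - 7)) := by ring
    have h5 := h.n_lo.trans h.n_le
    omega
  · refine (length_fieldList_le _ _ (by positivity) (by omega)).trans ?_
    have h1 : n / 2 ^ (a - 5) * ((l + 1) * 2 ^ (a - 5)) ≤ n * (2 * l) := by
      calc n / 2 ^ (a - 5) * ((l + 1) * 2 ^ (a - 5))
          = n / 2 ^ (a - 5) * 2 ^ (a - 5) * (l + 1) := by ring
        _ ≤ n * (2 * l) := Nat.mul_le_mul (Nat.div_mul_le_self _ _)
          (by have := h.l_pos; omega)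
    have h2 : n * (2 * l) = 2 * (n * l) := by ring
    rw [add_one_mul]
    omega
  · refine (length_fieldList_le _ _ hv h.L_lt).trans ?_
    have h1 := text_table_width_le h ha
    have h2 := h.table_mul_le (e := (l + 1) * 2 ^ (a - 5) + (l + 1) + (a - 5)) (by omega)
    omega
  · simp

theorem isIndex_dense (h : Sizes w n σ L l a) (ha : 2 * l + 8 < a)
    (hS : ∀ p ∈ Finset.Icc 1 n, S p ∈ Finset.Icc 1 σ) :
    IsIndex w n σ S (layout (denseParams w L l a) (denseArrays w n σ S L l a))
      (denseParams w L l a) (fun y b => keyRank S (L + 1) n (y * 2 ^ (L + 1) + b))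
      (fun _ _ => 302) := by
  have hD := denseData h ha hS
  have hw := (remWidth_dense h ha).1
  refine ⟨layout_par (params_le ?_ ?_ ?_ ?_ ?_ ?_ ?_ ?_ ?_ ?_), ?_, ?_, ?_⟩
  · omega
  · omega
  · exact h.L_lt
  · exact hD.u_le
  any_goals omega
  · intro s E m b y hM h3 hpar hb hy hbn hyσ
    have hbv : b < 2 ^ (L + 1) := hbn.trans_lt h.n_hi
    have hx := mul_two_pow_add_lt (L := L) hyσ hbv
    refine Runs.iteTrue ?_ (Runs.iteTrue ?_ ?_)
    · rw [hM.val 4 (by norm_num), hpar 0 (by norm_num)]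
      exact one_ne_zero
    · rw [hM.val 5 (by norm_num), hpar 1 (by norm_num)]
      exact one_ne_zero
    · refine (denseRank_runs hD (hasParams_of_eq h3 hpar) hM hb hy hbv hbn (hyσ.trans h.σ_hi) rfl
        (div_lt_groupCount hx) ?_ ?_).mono fun s' t ht => ⟨ht.1, ?_⟩
      · rw [Nat.div_lt_iff_lt_mul (by positivity), mul_assoc, ← pow_add,
          Nat.sub_add_cancel hD.se_le_v]
        exact hx
      · exact Nat.lt_succ_of_le (Nat.div_le_div_right hbn)
      · have := ht.2
        dsimp only
        omega
  · intro y _ i j hi hij hj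
    exact keyRank_add_rangeFreq h.n_hi (fun p hp => (Finset.mem_Icc.1 (hS p hp)).1) y hi hij hj
  · intro Ys b _
    rw [Finset.sum_const, smul_eq_mul, mul_comm _ 302]
    exact Nat.le_add_right _ _

theorem length_dense_le (h : Sizes w n σ L l a) (ha : 2 * l + 8 < a) (x : Fin 23) :
    (layout (denseParams w L l a) (denseArrays w n σ S L l a) x).length ≤ 1000 * (n * l) := by
  have hLn := h.L_lt_n.trans h.n_le
  have hl := h.l_le
  have hu := (remWidth_dense h ha).2
  have haL := h.a_le
  refine length_layout_le (params_le ?_ ?_ ?_ ?_ ?_ ?_ ?_ ?_ ?_ ?_) (length_denseArrays_le h ha) x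
  all_goals omega

end Dense

/-- Up to the threshold `2 * l + 8` a remainder has `O(l)` bits and can be stored for every
position; beyond it, ranks at block starts are rare enough to be stored for every symbol. -/
theorem exists_isIndex {w n σ : ℕ} {S : ℕ → ℕ} (hn : 2 ≤ n) (hnw : n < 2 ^ w) (hσw : σ < 2 ^ w)
    (hS : ∀ p ∈ Finset.Icc 1 n, S p ∈ Finset.Icc 1 σ) :
    ∃ D par ρ cost, IsIndex w n σ S D par ρ cost ∧
      ∀ x, (D x).length ≤ 1000 * (n * Nat.log 2 σ) := by
  have h1 := Finset.mem_Icc.1 (hS 1 (Finset.mem_Icc.2 (by omega)))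
  rcases (show 1 ≤ σ by omega).eq_or_lt with rfl | hσ
  · refine ⟨_, _, _, _, isIndex_trivial fun p hp => ?_, fun x => by simp⟩
    have := Finset.mem_Icc.1 (hS p hp)
    omega
  · have hZ := Sizes.of_log hn hσ hnw hσw
    rcases le_or_gt (Nat.log 2 (Nat.log 2 n / Nat.log 2 σ)) (2 * Nat.log 2 σ + 8) with ha | ha
    · exact ⟨_, _, _, _, isIndex_sparse hZ rfl ha hS, length_sparse_le hZ ha⟩
    · exact ⟨_, _, _, _, isIndex_dense hZ ha hS, length_dense_le hZ ha⟩

end WordRAM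

/-! ### Passing from rounded to real logarithms -/

theorem lemma7 :
    ∃ (C : ℝ) (K : ℕ) (query : WordRAM.Prog K),
      ∀ (w n σ : ℕ) (S : ℕ → ℕ), 2 ≤ n → n < 2 ^ w → σ < 2 ^ w →
        (∀ p ∈ Finset.Icc 1 n, S p ∈ Finset.Icc 1 σ) →
        ∃ D : Fin K → List Bool,
          ((∑ k, (D k).length : ℕ) : ℝ) ≤ C * ((n : ℝ) * Real.logb 2 σ) ∧
          ∀ (Y : List ℕ) (i j : ℕ), Y.Nodup → (∀ y ∈ Y, y ∈ Finset.Icc 1 σ) →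
            1 ≤ i → i ≤ j → j ≤ n →
            ∀ s : WordRAM.State w, IsFreqQuery i j Y s →
              ∃ (s' : WordRAM.State w) (t : ℕ),
                WordRAM.Exec (fun k => WordRAM.packBits w (D k)) query s s' t ∧
                HasFreqAnswers S i j Y s' ∧
                (t : ℝ) ≤ C * (1 + (Y.length : ℝ) + (σ : ℝ) / Real.logb 2 n) := by
  -- The constant must cover `23 * 1000` for space, `13 + 2 * 302` per symbol, and `2 * 1400000` for
  -- the scans at the two ends of the range.
  refine ⟨3000000, 23, WordRAM.queryProg, fun w n σ S hn hnw hσw hS => ?_⟩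
  obtain ⟨D, par, ρ, cost, hI, hlen⟩ := WordRAM.exists_isIndex hn hnw hσw hS
  have hlog : ∀ m : ℕ, 1 ≤ m → (Nat.log 2 m : ℝ) ≤ Real.logb 2 m := fun m hm => by
    exact_mod_cast Real.natLog_le_logb m 2
  refine ⟨D, ?_, fun Y i j hYn hY hi hij hj s hs => ?_⟩
  · have h1 : ∑ k, (D k).length ≤ 23 * (1000 * (n * Nat.log 2 σ)) := by
      refine (Finset.sum_le_card_nsmul _ _ _ fun x _ => hlen x).trans ?_
      simp
    have hσ : 1 ≤ σ := by
      have := Finset.mem_Icc.1 (hS 1 (Finset.mem_Icc.2 (by omega)))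
      omega
    have h2 : (n : ℝ) * Nat.log 2 σ ≤ n * Real.logb 2 σ :=
      mul_le_mul_of_nonneg_left (hlog σ hσ) (Nat.cast_nonneg n)
    have h3 : (0 : ℝ) ≤ n * Nat.log 2 σ := by positivity
    calc ((∑ k, (D k).length : ℕ) : ℝ) ≤ ((23 * (1000 * (n * Nat.log 2 σ)) : ℕ) : ℝ) := by
          exact_mod_cast h1
      _ = 23000 * ((n : ℝ) * Nat.log 2 σ) := by push_cast; ring
      _ ≤ _ := by linarith
  · have hw : 0 < w := by
      rcases Nat.eq_zero_or_pos w with rfl | h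
      · simp at hnw; omega
      · exact h
    obtain ⟨s', t, h1, h2, h3⟩ := WordRAM.queryProg_runs (cost := cost) hnw hσw hw hI.par_eq hI.ranks
      (fun y hy => hI.freq y hy i j hi hij hj) hi hij hj hYn hY hs
    refine ⟨s', t, h1, h2, ?_⟩
    -- Truncated subtraction is injective here because symbols are at least one.
    have hinj : Set.InjOn (fun y => y - 1) (Y.toFinset : Set ℕ) := fun y hy y' hy' h => by
      have := Finset.mem_Icc.1 (hY y (by simpa using hy))
      have := Finset.mem_Icc.1 (hY y' (by simpa using hy'))
      simp only at h
      omega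
    have hsum : ∀ f : ℕ → ℕ, (Y.map fun y => f (y - 1)).sum
        = ∑ y ∈ Y.toFinset.image (fun y => y - 1), f y := fun f => by
      rw [Finset.sum_image hinj, List.sum_toFinset _ hYn]
    have hcard : (Y.toFinset.image (fun y => y - 1)).card = Y.length := by
      rw [Finset.card_image_of_injOn hinj, List.toFinset_card_of_nodup hYn]
    have h4 := hI.cost_le (Y.toFinset.image fun y => y - 1) (i - 1) (by omega)
    have h5 := hI.cost_le (Y.toFinset.image fun y => y - 1) j hj
    rw [hcard, ← hsum] at h4 h5
    have h6 : (Y.map fun y => 13 + cost (y - 1) (i - 1) + cost (y - 1) j).sum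
        = 13 * Y.length + (Y.map fun y => cost (y - 1) (i - 1)).sum
          + (Y.map fun y => cost (y - 1) j).sum := by
      rw [List.sum_map_add, List.sum_map_add]
      simp [mul_comm]
    rw [h6] at h3
    generalize (Y.map fun y => cost (y - 1) (i - 1)).sum = A at *
    generalize (Y.map fun y => cost (y - 1) j).sum = B at *
    have hL : 1 ≤ Nat.log 2 n := Nat.log_pos one_lt_two hn
    have hLR : (1 : ℝ) ≤ Nat.log 2 n := by exact_mod_cast hL
    -- Rounding down loses less than one, and the rounded logarithm is at least one since `2 ≤ n`.
    have h7 : Real.logb 2 n ≤ 2 * Nat.log 2 n := by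
      have h8 : (n : ℝ) ≤ 2 ^ ((Nat.log 2 n + 1 : ℕ) : ℝ) := by
        rw [Real.rpow_natCast]
        exact_mod_cast (Nat.lt_pow_succ_log_self one_lt_two n).le
      have h9 := Real.logb_le_logb_of_le one_lt_two (by positivity : (0 : ℝ) < n) h8
      rw [Real.logb_rpow (by norm_num) (by norm_num)] at h9
      push_cast at h9
      linarith
    have h8 : 0 < Real.logb 2 n := lt_of_lt_of_le (by linarith) (hlog n (by omega))
    have h9 : ∀ X : ℕ, X * Nat.log 2 n ≤ 302 * Y.length * Nat.log 2 n + 700000 * σ →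
        (X : ℝ) ≤ 302 * Y.length + 1400000 * (σ / Real.logb 2 n) := fun X hX => by
      have hX' : (X : ℝ) * Nat.log 2 n ≤ 302 * Y.length * Nat.log 2 n + 700000 * σ := by
        exact_mod_cast hX
      have h10 : (σ : ℝ) ≤ 2 * (σ / Real.logb 2 n) * Nat.log 2 n := by
        have : (σ : ℝ) / Real.logb 2 n * Real.logb 2 n = σ := div_mul_cancel₀ _ h8.ne'
        have h11 : (σ : ℝ) / Real.logb 2 n * Real.logb 2 n
          ≤ σ / Real.logb 2 n * (2 * Nat.log 2 n) :=
          mul_le_mul_of_nonneg_left h7 (div_nonneg (Nat.cast_nonneg _) h8.le)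
        linarith
      have hpos : (0 : ℝ) < Nat.log 2 n := by linarith
      refine le_of_mul_le_mul_right ?_ hpos
      calc (X : ℝ) * Nat.log 2 n ≤ 302 * Y.length * Nat.log 2 n + 700000 * σ := hX'
        _ ≤ 302 * Y.length * Nat.log 2 n
          + 700000 * (2 * (σ / Real.logb 2 n) * Nat.log 2 n) := by linarith
        _ = _ := by ring
    have hA := h9 A h4
    have hB := h9 B h5
    have ht : (t : ℝ) ≤ 18 + (13 * Y.length + A + B) := by exact_mod_cast h3
    have hY0 : (0 : ℝ) ≤ Y.length := Nat.cast_nonneg _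
    have hq0 : 0 ≤ (σ : ℝ) / Real.logb 2 n := div_nonneg (Nat.cast_nonneg _) h8.le
    linarith
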